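/- Let $\Theta$ be a compact subset of a separable metric space and let $H:\Theta\times\mathbb{R}\to\mathbb{R}$ be such that $\theta\mapsto H(\theta,x)$ is continuous on $\Theta$ for each $x\in\mathbb{R}$, and $x\mapsto H(\theta,x)$ is measurable for each $\theta\in\Theta$. Let $X_1,X_2,\ldots$ be i.i.d. real random variables. For each $n\in\mathbb{N}$ let $W_{n1},\ldots,W_{nn}$ be real random variables that are negatively orthant dependent (NOD), that is, for all $w_1,\ldots,w_n\in\mathbb{R}$, \[ \mathbb{P}(W_{n1}\le w_1,\ldots,W_{nn}\le w_n)\le\prod_{j=1}^n\mathbb{P}(W_{nj}\le w_j) \quad\text{and}\quad \mathbb{P}(W_{n1}>w_1,\ldots,W_{nn}>w_n)\le\prod_{j=1}^n\mathbb{P}(W_{nj}>w_j). \] Suppose that the vectors $(W_{n1},\ldots,W_{nn})$, $n\in\mathbb{N}$, are independent of one another and that each of them is independent of the sequence $(X_1,X_2,\ldots)$. Let $p\in[1,2)$, $\alpha>2p$ and $\beta>1$ satisfy $\alpha^{-1}+\beta^{-1}=p^{-1}$, and suppose that \[ \mathbb{E}\Big(\sup_{\theta\in\Theta}|H(\theta,X_1)|^{\beta}\Big)<\infty,\qquad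 \sum_{j=1}^n\mathbb{E}(|W_{nj}|^{\alpha})=O(n),\qquad \sum_{j=1}^n\mathbb{E}(|W_{nj}|)=O(n^{1/p}) \] as $n\to\infty$. Then, for all sufficiently large $n$, $W_{nj}H(\theta,X_j)$ is integrable for all $1\le j\le n$ and $\theta\in\Theta$, and \[ \sup_{\theta\in\Theta}\bigg|\frac{1}{n^{1/p}}\sum_{j=1}^n\Big(W_{nj}H(\theta,X_j)-\mathbb{E}\big(W_{nj}H(\theta,X_j)\big)\Big)\bigg|\xrightarrow[n\to\infty]{}0\quad\text{almost surely.} \] -/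

import Mathlib

open MeasureTheory ProbabilityTheory Filter Topology
open scoped NNReal ENNReal

/-- A finite family `Y` of real random variables is negatively orthant dependent (NOD) under `P`
if, for all thresholds `x`, the joint lower and upper orthant probabilities are at most the
products of the marginal ones. -/
structure IsNOD {Ω ι : Type*} [MeasurableSpace Ω] [Fintype ι] (Y : ι → Ω → ℝ) (P : Measure Ω) :
    Prop where
  lower : ∀ x : ι → ℝ, P {ω | ∀ i, Y i ω ≤ x i} ≤ ∏ i, P {ω | Y i ω ≤ x i}
  upper : ∀ x : ι → ℝ, P {ω | ∀ i, x i < Y i ω} ≤ ∏ i, P {ω | x i < Y i ω}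

/-!
Let `L = n ^ (1 / p)`. For one nonnegative function `h` of the sample and one of the two monotone
parts `g` of the weights, the summands `g (W n j) * h (X j)` are truncated: `h (X j)` at
`n ^ (1 / β)` and the product at `ε * L`. Since `E h(X) ^ β < ∞`, almost surely the first truncation
is eventually inactive for all `j < n` at once (`ae_eventually_forall_sample_le`); only the sample,
which is shared by all rows, is used here. Given the first truncation, the `α`-th moments of the
summands divided by `L` add up to a convergent series in `n` (`tsum_lintegral_min_rpow_ne_top`,
`exists_sum_lintegral_rpow_le`), because `α / p = 1 + α / β` and `α > β`. So the second truncation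
is eventually inactive as well, and the expectations change by `o(L)`
(`eventually_abs_sum_integral_sub_le`).

The truncated summands are, conditionally on the sample, monotone continuous functions of negatively
orthant dependent variables, all in the same direction. Their joint exponential moments are
therefore at most the products of the marginal ones (`IsNOD.lintegral_prod_le_of_indepFun`, a
layer-cake argument), which gives a Bernstein inequality. The sum of the second moments is
`O(n ^ (2 / p - γ))` for some `γ > 0`, so deviations of size `δ * L` have probability `O(n ^ (-2))`
when `ε` is a small multiple of `δ`, and the Borel–Cantelli lemma applies
(`exists_ae_eventually_abs_sum_sub_lt`).

By linearity this gives the law for `W` and for `|W|` with a fixed function of the sample. For the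
supremum over the compact parameter set, the functions `H θ` with `θ` in a small ball around `θ₀`
differ from `H θ₀` by at most a function `o` of small mean. The difference of the centred sums is
controlled by the law for `|W|` and `o`, together with `∑ E|W n j| = O(L)`
(`exists_ball_ae_eventually_forall_abs_sum_sub_le`), and finitely many balls suffice.
-/

/-! ### Products of monotone functions of negatively orthant dependent variables -/

theorem exists_antitone_iUnion_Ioi {U : Set ℝ} (hne : U.Nonempty) (ho : IsOpen U)
    (hU : IsUpperSet U) : ∃ c : ℕ → ℝ, Antitone c ∧ U = ⋃ k, Set.Ioi (c k) := by
  by_cases hb : BddBelow U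
  · refine ⟨fun _ => sInf U, antitone_const, ?_⟩
    rw [Set.iUnion_const]
    refine Set.Subset.antisymm (fun x hx => ?_) (fun x hx => ?_)
    · obtain ⟨l, hl, hlx⟩ := exists_Ioc_subset_of_mem_nhds (ho.mem_nhds hx) ⟨x - 1, by simp⟩
      have : (l + x) / 2 ∈ U := hlx ⟨by linarith, by linarith⟩
      have := csInf_le hb this
      simp only [Set.mem_Ioi]
      linarith
    · obtain ⟨y, hy, hyx⟩ := exists_lt_of_csInf_lt hne hx
      exact hU hyx.le hy
  · refine ⟨fun k => -k, fun a b hab => by simpa using hab, ?_⟩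
    have h1 : U = Set.univ := by
      refine Set.eq_univ_of_forall fun x => ?_
      rw [not_bddBelow_iff] at hb
      obtain ⟨y, hy, hyx⟩ := hb x
      exact hU hyx.le hy
    rw [h1, eq_comm, Set.eq_univ_iff_forall]
    intro x
    obtain ⟨k, hk⟩ := exists_nat_gt (-x)
    exact Set.mem_iUnion.2 ⟨k, by simp only [Set.mem_Ioi]; linarith⟩

theorem exists_monotone_iUnion_Iic {U : Set ℝ} (hne : U.Nonempty) (ho : IsOpen U)
    (hU : IsLowerSet U) : ∃ c : ℕ → ℝ, Monotone c ∧ U = ⋃ k, Set.Iic (c k) := by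
  obtain ⟨c, hc, hcU⟩ := exists_antitone_iUnion_Ioi (U := -U) hne.neg ho.neg
    (fun a b hab ha => hU (neg_le_neg hab) ha)
  refine ⟨fun k => -c k - 1 / (k + 1 : ℝ), fun a b hab => ?_, ?_⟩
  · have h1 := hc hab
    have h2 : 1 / (b + 1 : ℝ) ≤ 1 / (a + 1 : ℝ) := Nat.one_div_le_one_div hab
    simp only
    linarith
  · ext x
    have hx : x ∈ U ↔ -x ∈ -U := by simp
    rw [hx, hcU]
    simp only [Set.mem_iUnion, Set.mem_Ioi, Set.mem_Iic]
    constructor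
    · rintro ⟨i, hi⟩
      obtain ⟨k, hk⟩ := exists_nat_one_div_lt (sub_pos.2 hi)
      refine ⟨max i k, ?_⟩
      have h1 := hc (le_max_left i k)
      have h2 : 1 / (((max i k : ℕ) : ℝ) + 1) ≤ 1 / (k + 1 : ℝ) :=
        Nat.one_div_le_one_div (le_max_right i k)
      linarith
    · rintro ⟨i, hi⟩
      exact ⟨i, by have : 0 < 1 / (i + 1 : ℝ) := Nat.one_div_pos_of_nat
                   linarith⟩

namespace IsNOD

variable {Ω ι : Type*} [MeasurableSpace Ω] [Fintype ι] {Y : ι → Ω → ℝ} {P : Measure Ω}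

/-- The product inequality passes to increasing unions, by continuity from below. -/
theorem measure_forall_mem_le_of_iUnion [IsFiniteMeasure P] {A : ι → ℕ → Set ℝ}
    (hA : ∀ i, Monotone (A i))
    (h : ∀ k, P {ω | ∀ i, Y i ω ∈ A i k} ≤ ∏ i, P {ω | Y i ω ∈ A i k}) :
    P {ω | ∀ i, Y i ω ∈ ⋃ k, A i k} ≤ ∏ i, P {ω | Y i ω ∈ ⋃ k, A i k} := by
  have h1 : {ω | ∀ i, Y i ω ∈ ⋃ k, A i k} = ⋃ k, {ω | ∀ i, Y i ω ∈ A i k} := by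
    ext ω
    simp only [Set.mem_ofPred_eq, Set.mem_iUnion]
    refine ⟨fun H => ?_, fun ⟨k, hk⟩ i => ⟨k, hk i⟩⟩
    choose f hf using H
    exact ⟨Finset.univ.sup f, fun i => hA i (Finset.le_sup (Finset.mem_univ i)) (hf i)⟩
  have hmono : Monotone fun k => {ω | ∀ i, Y i ω ∈ A i k} :=
    fun a b hab ω hω i => hA i hab (hω i)
  rw [h1]
  refine le_of_tendsto_of_tendsto' (tendsto_measure_iUnion_atTop hmono)
    (ENNReal.tendsto_finsetProd_of_ne_top Finset.univ (f := fun i k => P {ω | Y i ω ∈ A i k})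
      (fun i _ => ?_) (fun i _ => measure_ne_top _ _)) h
  have h2 : {ω | Y i ω ∈ ⋃ k, A i k} = ⋃ k, {ω | Y i ω ∈ A i k} := by
    ext ω; simp
  rw [h2]
  exact tendsto_measure_iUnion_atTop fun a b hab ω hω => hA i hab hω

/-- The orthant inequalities extend to all open upper rays and to all open lower rays. -/
theorem measure_forall_mem_le [IsFiniteMeasure P] (hY : IsNOD Y P) {U : ι → Set ℝ}
    (ho : ∀ i, IsOpen (U i)) (hU : (∀ i, IsUpperSet (U i)) ∨ ∀ i, IsLowerSet (U i)) :
    P {ω | ∀ i, Y i ω ∈ U i} ≤ ∏ i, P {ω | Y i ω ∈ U i} := by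
  by_cases hne : ∀ i, (U i).Nonempty
  · rcases hU with hU | hU
    · choose c hc hcU using fun i => exists_antitone_iUnion_Ioi (hne i) (ho i) (hU i)
      simp_rw [hcU]
      exact measure_forall_mem_le_of_iUnion
        (fun i a b hab => Set.Ioi_subset_Ioi (hc i hab)) fun k => hY.upper fun i => c i k
    · choose c hc hcU using fun i => exists_monotone_iUnion_Iic (hne i) (ho i) (hU i)
      simp_rw [hcU]
      exact measure_forall_mem_le_of_iUnion
        (fun i a b hab => Set.Iic_subset_Iic.2 (hc i hab)) fun k => hY.lower fun i => c i k
  · push Not at hne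
    obtain ⟨i, hi⟩ := hne
    have : {ω | ∀ i, Y i ω ∈ U i} = ∅ :=
      Set.eq_empty_of_forall_notMem fun ω hω => by simpa [hi] using hω i
    simp [this]

/-- If `P (∀ i, Y i ∈ U i)` is at most the product of the marginal probabilities for all sets `U i`
in a class `G` that contains the strict superlevel sets of the functions in `F`, then the same
product inequality holds for expectations of functions in `F`. The indicator functions are replaced
by functions in `F` one index at a time, `s` being the set of the indices already treated. -/
theorem lintegral_prod_le_of_superlevel [IsFiniteMeasure P] (hYm : ∀ i, Measurable (Y i))
    {F : Set (ℝ → ℝ)} {G : Set (Set ℝ)}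
    (hF : ∀ f ∈ F, Continuous f ∧ 0 ≤ f ∧ ∀ v, {x | v < f x} ∈ G)
    (hGm : ∀ U ∈ G, MeasurableSet U)
    (hG : ∀ U : ι → Set ℝ, (∀ i, U i ∈ G) →
      P {ω | ∀ i, Y i ω ∈ U i} ≤ ∏ i, P {ω | Y i ω ∈ U i}) (s : Finset ι) :
    ∀ φ : ι → ℝ → ℝ≥0∞, (∀ i ∈ s, ∃ f ∈ F, φ i = fun x => ENNReal.ofReal (f x)) →
      (∀ i ∉ s, ∃ U ∈ G, φ i = U.indicator 1) →
      ∫⁻ ω, ∏ i, φ i (Y i ω) ∂P ≤ ∏ i, ∫⁻ ω, φ i (Y i ω) ∂P := by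
  classical
  induction s using Finset.induction_on with
  | empty =>
    intro φ _ h
    choose U hU hφ using fun i => h i (Finset.notMem_empty i)
    have h1 : ∀ ω, ∏ i, φ i (Y i ω) = {ω | ∀ i, Y i ω ∈ U i}.indicator 1 ω := by
      intro ω
      by_cases hω : ∀ i, Y i ω ∈ U i
      · rw [Set.indicator_of_mem (by exact hω)]
        exact Finset.prod_eq_one fun i _ => by rw [hφ, Set.indicator_of_mem (hω i)]; rfl
      · rw [Set.indicator_of_notMem (by exact hω)]
        push Not at hω
        obtain ⟨i, hi⟩ := hω
        exact Finset.prod_eq_zero (Finset.mem_univ i) (by rw [hφ, Set.indicator_of_notMem hi])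
    have h2 : ∀ i ω, φ i (Y i ω) = {ω | Y i ω ∈ U i}.indicator 1 ω := by
      intro i ω
      rw [hφ]; rfl
    have h3 : ∀ i, MeasurableSet {ω | Y i ω ∈ U i} := fun i => hYm i (hGm _ (hU i))
    have h4 : MeasurableSet {ω | ∀ i, Y i ω ∈ U i} := by
      rw [Set.ofPred_forall]; exact MeasurableSet.iInter h3
    simp_rw [h1, h2]
    rw [lintegral_indicator_one h4]
    simp_rw [fun i => lintegral_indicator_one (μ := P) (h3 i)]
    exact hG U hU
  | insert a s ha ih =>
    intro φ hs hns
    obtain ⟨f, hf, hφ⟩ := hs a (Finset.mem_insert_self a s)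
    obtain ⟨hfc, hf0, hfG⟩ := hF f hf
    have hφm : ∀ i, Measurable (φ i) := by
      intro i
      by_cases hi : i ∈ insert a s
      · obtain ⟨f, hf, hφ⟩ := hs i hi
        rw [hφ]
        exact (hF f hf).1.measurable.ennreal_ofReal
      · obtain ⟨U, hU, hφ⟩ := hns i hi
        rw [hφ]
        exact measurable_one.indicator (hGm U hU)
    -- the layer-cake representation of `φ a`
    have hlayer : ∀ x, φ a x = ∫⁻ v in Set.Ici (0 : ℝ), {x | v < f x}.indicator 1 x := by
      intro x
      have h1 : ∀ v : ℝ, ({x | v < f x}.indicator 1 x : ℝ≥0∞) = (Set.Iio (f x)).indicator 1 v :=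
        fun v => rfl
      simp_rw [h1]
      rw [lintegral_indicator_one measurableSet_Iio, Measure.restrict_apply measurableSet_Iio,
        Set.inter_comm, Set.Ici_inter_Iio, Real.volume_Ico, sub_zero, hφ]
    have hm : Measurable fun q : Ω × ℝ => ({x | q.2 < f x}.indicator 1 (Y a q.1) : ℝ≥0∞) := by
      have h1 : MeasurableSet {q : Ω × ℝ | q.2 < f (Y a q.1)} :=
        measurableSet_lt measurable_snd ((hfc.measurable.comp (hYm a)).comp measurable_fst)
      exact measurable_one.indicator h1
    have hR : Measurable fun ω => ∏ i ∈ Finset.univ.erase a, φ i (Y i ω) :=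
      Finset.measurable_prod _ fun i _ => (hφm i).comp (hYm i)
    have hsplit : ∀ ω, ∏ i, φ i (Y i ω) = ∫⁻ v in Set.Ici (0 : ℝ),
        {x | v < f x}.indicator 1 (Y a ω) * ∏ i ∈ Finset.univ.erase a, φ i (Y i ω) := by
      intro ω
      have h1 : Measurable fun v : ℝ => ({x | v < f x}.indicator 1 (Y a ω) : ℝ≥0∞) :=
        hm.comp measurable_prodMk_left
      rw [lintegral_mul_const _ h1, ← hlayer,
        Finset.mul_prod_erase _ (fun i => φ i (Y i ω)) (Finset.mem_univ a)]
    have hswap : ∫⁻ ω, φ a (Y a ω) ∂P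
        = ∫⁻ v in Set.Ici (0 : ℝ), ∫⁻ ω, {x | v < f x}.indicator 1 (Y a ω) ∂P := by
      simp_rw [hlayer]
      exact lintegral_lintegral_swap hm.aemeasurable
    simp_rw [hsplit]
    rw [lintegral_lintegral_swap (hm.mul (hR.comp measurable_fst)).aemeasurable,
      ← Finset.mul_prod_erase _ _ (Finset.mem_univ a), hswap,
      ← lintegral_mul_const]
    · refine lintegral_mono fun v => ?_
      have key := ih (Function.update φ a ({x | v < f x}.indicator 1)) (fun i hi => ?_)
        (fun i hi => ?_)
      · rw [← Finset.mul_prod_erase _ _ (Finset.mem_univ a)] at key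
        have e1 : ∀ ω, ∏ i, Function.update φ a ({x | v < f x}.indicator 1) i (Y i ω)
            = {x | v < f x}.indicator 1 (Y a ω) * ∏ i ∈ Finset.univ.erase a, φ i (Y i ω) := by
          intro ω
          rw [← Finset.mul_prod_erase _ _ (Finset.mem_univ a), Function.update_self]
          congr 1
          refine Finset.prod_congr rfl fun i hi => ?_
          rw [Function.update_of_ne (Finset.ne_of_mem_erase hi)]
        simp_rw [e1] at key
        rw [Function.update_self] at key
        refine key.trans (le_of_eq ?_)
        congr 1
        refine Finset.prod_congr rfl fun i hi => ?_
        rw [Function.update_of_ne (Finset.ne_of_mem_erase hi)]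
      · have : i ≠ a := fun h => ha (h ▸ hi)
        rw [Function.update_of_ne this]
        exact hs i (Finset.mem_insert_of_mem hi)
      · by_cases hia : i = a
        · subst hia
          exact ⟨_, hfG v, Function.update_self ..⟩
        · rw [Function.update_of_ne hia]
          exact hns i (by simp [hia, hi])
    · exact hm.lintegral_prod_left'

/-- Negatively orthant dependent variables satisfy `E ∏ fᵢ(Yᵢ) ≤ ∏ E fᵢ(Yᵢ)` for nonnegative
continuous functions that are all nondecreasing or all nonincreasing. -/
theorem lintegral_prod_le [IsFiniteMeasure P] (hY : IsNOD Y P) (hYm : ∀ i, Measurable (Y i))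
    {f : ι → ℝ → ℝ} (hfc : ∀ i, Continuous (f i)) (hf0 : ∀ i, 0 ≤ f i)
    (hf : (∀ i, Monotone (f i)) ∨ ∀ i, Antitone (f i)) :
    ∫⁻ ω, ∏ i, ENNReal.ofReal (f i (Y i ω)) ∂P
      ≤ ∏ i, ∫⁻ ω, ENNReal.ofReal (f i (Y i ω)) ∂P := by
  rcases hf with hf | hf
  · refine lintegral_prod_le_of_superlevel hYm (F := {f | Continuous f ∧ 0 ≤ f ∧ Monotone f})
      (G := {U | IsOpen U ∧ IsUpperSet U}) (fun f hf => ⟨hf.1, hf.2.1, fun v => ⟨?_, ?_⟩⟩)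
      (fun U hU => hU.1.measurableSet)
      (fun U hU => hY.measure_forall_mem_le (fun i => (hU i).1) (Or.inl fun i => (hU i).2))
      Finset.univ (fun i x => ENNReal.ofReal (f i x))
      (fun i _ => ⟨f i, ⟨hfc i, hf0 i, hf i⟩, rfl⟩) (fun i hi => absurd (Finset.mem_univ i) hi)
    · exact isOpen_lt continuous_const hf.1
    · exact fun a b hab ha => lt_of_lt_of_le ha (hf.2.2 hab)
  · refine lintegral_prod_le_of_superlevel hYm (F := {f | Continuous f ∧ 0 ≤ f ∧ Antitone f})
      (G := {U | IsOpen U ∧ IsLowerSet U}) (fun f hf => ⟨hf.1, hf.2.1, fun v => ⟨?_, ?_⟩⟩)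
      (fun U hU => hU.1.measurableSet)
      (fun U hU => hY.measure_forall_mem_le (fun i => (hU i).1) (Or.inr fun i => (hU i).2))
      Finset.univ (fun i x => ENNReal.ofReal (f i x))
      (fun i _ => ⟨f i, ⟨hfc i, hf0 i, hf i⟩, rfl⟩) (fun i hi => absurd (Finset.mem_univ i) hi)
    · exact isOpen_lt continuous_const hf.1
    · exact fun a b hab ha => lt_of_lt_of_le ha (hf.2.2 hab)

/-- Randomizing the functions in `IsNOD.lintegral_prod_le` by independent variables that are
independent of the family `Y`. -/
theorem lintegral_prod_le_of_indepFun [IsProbabilityMeasure P] (hY : IsNOD Y P)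
    (hYm : ∀ i, Measurable (Y i)) {X : ι → Ω → ℝ} (hXm : ∀ i, Measurable (X i))
    (hX : iIndepFun X P) (hYX : IndepFun (fun ω i => Y i ω) (fun ω i => X i ω) P)
    {f : ℝ → ℝ → ℝ} (hfm : Measurable (Function.uncurry f))
    (hfc : ∀ x, Continuous fun y => f y x) (hf0 : ∀ y x, 0 ≤ f y x)
    (hf : (∀ x, Monotone fun y => f y x) ∨ ∀ x, Antitone fun y => f y x) :
    ∫⁻ ω, ∏ i, ENNReal.ofReal (f (Y i ω) (X i ω)) ∂P
      ≤ ∏ i, ∫⁻ ω, ENNReal.ofReal (f (Y i ω) (X i ω)) ∂P := by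
  have hYm' : Measurable fun ω i => Y i ω := measurable_pi_lambda _ hYm
  have hXm' : Measurable fun ω i => X i ω := measurable_pi_lambda _ hXm
  have hG : Measurable fun q : ℝ × ℝ => ENNReal.ofReal (f q.1 q.2) := hfm.ennreal_ofReal
  have hjoint := hYX.map_prod_eq_prod_map_map hYm'.aemeasurable hXm'.aemeasurable
  have : IsProbabilityMeasure (P.map fun ω i => Y i ω) :=
    Measure.isProbabilityMeasure_map hYm'.aemeasurable
  have : IsProbabilityMeasure (P.map fun ω i => X i ω) :=
    Measure.isProbabilityMeasure_map hXm'.aemeasurable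
  set g : ι → ℝ → ℝ≥0∞ := fun i x => ∫⁻ ω, ENNReal.ofReal (f (Y i ω) x) ∂P with hg
  have hgm : ∀ i, Measurable (g i) := fun i =>
    (hG.comp (((hYm i).comp measurable_snd).prodMk measurable_fst)).lintegral_prod_right'
  have hprodm : Measurable fun q : (ι → ℝ) × (ι → ℝ) =>
      ∏ i, ENNReal.ofReal (f (q.1 i) (q.2 i)) :=
    Finset.measurable_prod _ fun i _ =>
      hfm.ennreal_ofReal.comp (f := fun q : (ι → ℝ) × (ι → ℝ) => (q.1 i, q.2 i))
        (((measurable_pi_apply i).comp measurable_fst).prodMk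
        ((measurable_pi_apply i).comp measurable_snd))
  -- the expectation of each factor, conditioned on `X`
  have hone : ∀ i, ∫⁻ ω, ENNReal.ofReal (f (Y i ω) (X i ω)) ∂P = ∫⁻ ω, g i (X i ω) ∂P := by
    intro i
    have hi : IndepFun (Y i) (X i) P :=
      hYX.comp (φ := fun y : ι → ℝ => y i) (ψ := fun x : ι → ℝ => x i) (measurable_pi_apply i)
        (measurable_pi_apply i)
    have hj := hi.map_prod_eq_prod_map_map (hYm i).aemeasurable (hXm i).aemeasurable
    have : IsProbabilityMeasure (P.map (Y i)) :=
      Measure.isProbabilityMeasure_map (hYm i).aemeasurable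
    have : IsProbabilityMeasure (P.map (X i)) :=
      Measure.isProbabilityMeasure_map (hXm i).aemeasurable
    rw [← lintegral_map (f := fun q : ℝ × ℝ => ENNReal.ofReal (f q.1 q.2)) hG
      ((hYm i).prodMk (hXm i)), hj, lintegral_prod_symm _ hG.aemeasurable,
      lintegral_map hG.lintegral_prod_left' (hXm i)]
    refine lintegral_congr fun ω => ?_
    have hω : Measurable fun y : ℝ => ENNReal.ofReal (f y (X i ω)) :=
      hG.comp (f := fun y : ℝ => (y, X i ω)) measurable_prodMk_right
    exact lintegral_map hω (hYm i)
  simp_rw [hone]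
  rw [← lintegral_map (f := fun q : (ι → ℝ) × (ι → ℝ) =>
      ∏ i, ENNReal.ofReal (f (q.1 i) (q.2 i))) hprodm (hYm'.prodMk hXm'), hjoint,
    lintegral_prod_symm _ hprodm.aemeasurable, lintegral_map hprodm.lintegral_prod_left' hXm',
    ← lintegral_prod_eq_prod_lintegral_of_indepFun Finset.univ (fun i ω => g i (X i ω))
      (hX.comp g hgm) (fun i => (hgm i).comp (hXm i))]
  refine lintegral_mono fun ω => ?_
  simp only
  have hω : Measurable fun y : ι → ℝ => ∏ i, ENNReal.ofReal (f (y i) (X i ω)) :=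
    hprodm.comp (f := fun y : ι → ℝ => (y, fun i => X i ω)) measurable_prodMk_right
  rw [lintegral_map hω hYm']
  exact hY.lintegral_prod_le hYm (f := fun i y => f y (X i ω)) (fun i => hfc _)
    (fun i y => hf0 _ _) (hf.imp (fun h i => h _) (fun h i => h _))

end IsNOD

/-! ### Exponential and moment inequalities -/

/-- A second-order bound for the exponential on `[0, y]`, for `t` of either sign. -/
theorem exp_mul_le_one_add_mul_add {y z : ℝ} (hy : 0 < y) (hz : 0 ≤ z) (hzy : z ≤ y) (t : ℝ) :
    Real.exp (t * z) ≤ 1 + t * z + z ^ 2 * (2 * Real.exp (2 * (|t| * y)) / y ^ 2) := by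
  have h1 : ∀ u : ℝ, Real.exp u ≤ 1 + u + u ^ 2 * Real.exp |u| := by
    intro u
    have h2 : Real.exp u * (1 - u) ≤ 1 := by
      have h3 := Real.add_one_le_exp (-u)
      have h4 : Real.exp u * Real.exp (-u) = 1 := by rw [← Real.exp_add]; simp
      nlinarith [Real.exp_pos u]
    rcases le_total 0 u with hu | hu
    · rw [abs_of_nonneg hu]
      nlinarith [mul_nonneg hu (sub_nonneg.2 h2)]
    · have h3 := Real.add_one_le_exp u
      have h4 : 1 ≤ Real.exp |u| := Real.one_le_exp (abs_nonneg u)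
      nlinarith [mul_nonneg (neg_nonneg.2 hu) (sub_nonneg.2 h3),
        mul_nonneg (sq_nonneg u) (sub_nonneg.2 h4)]
  refine (h1 (t * z)).trans ?_
  have hv : 0 ≤ |t| * y := by positivity
  have h5 : (|t| * y) ^ 2 ≤ 2 * Real.exp (|t| * y) := by
    have := Real.quadratic_le_exp_of_nonneg hv
    nlinarith
  have h6 : |t * z| ≤ |t| * y := by
    rw [abs_mul, abs_of_nonneg hz]; gcongr
  have h7 : (t * z) ^ 2 * Real.exp |t * z|
      ≤ z ^ 2 * (2 * Real.exp (2 * (|t| * y)) / y ^ 2) := by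
    have e1 : (t * z) ^ 2 = z ^ 2 * ((|t| * y) ^ 2 / y ^ 2) := by
      rw [mul_pow, mul_pow, sq_abs]; field_simp
    have e2 : Real.exp (2 * (|t| * y)) = Real.exp (|t| * y) * Real.exp (|t| * y) := by
      rw [← Real.exp_add, two_mul]
    rw [e1, e2, mul_assoc]
    refine mul_le_mul_of_nonneg_left ?_ (sq_nonneg z)
    rw [div_mul_eq_mul_div]
    refine div_le_div_of_nonneg_right ?_ (sq_nonneg y)
    rw [← mul_assoc]
    exact mul_le_mul h5 (Real.exp_le_exp.2 h6) (Real.exp_pos _).le (by positivity)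
  linarith

/-- A Bernstein-type inequality for a finite family with values in `[0, y]` whose joint exponential
moments are dominated by the product of the marginal ones. -/
theorem measure_abs_sum_sub_integral_ge_le {Ω ι : Type*} [MeasurableSpace Ω] [Fintype ι]
    {P : Measure Ω} [IsProbabilityMeasure P] {Z : ι → Ω → ℝ} {y : ℝ} (hy : 0 < y)
    (hZm : ∀ i, Measurable (Z i)) (hZ0 : ∀ i ω, 0 ≤ Z i ω) (hZy : ∀ i ω, Z i ω ≤ y)
    (hmgf : ∀ t, mgf (fun ω => ∑ i, Z i ω) P t ≤ ∏ i, mgf (Z i) P t)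
    {t : ℝ} (ht : 0 ≤ t) (x : ℝ) :
    P.real {ω | x ≤ |∑ i, (Z i ω - ∫ ω', Z i ω' ∂P)|}
      ≤ 2 * Real.exp (-(t * x)
        + (∑ i, ∫ ω, Z i ω ^ 2 ∂P) * (2 * Real.exp (2 * (t * y)) / y ^ 2)) := by
  have hZi : ∀ i, Integrable (Z i) P := fun i =>
    Integrable.of_bound (hZm i).aestronglyMeasurable y
      (ae_of_all _ fun ω => by rw [Real.norm_of_nonneg (hZ0 i ω)]; exact hZy i ω)
  have hZ2 : ∀ i, Integrable (fun ω => Z i ω ^ 2) P := fun i =>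
    Integrable.of_bound ((hZm i).pow_const 2).aestronglyMeasurable (y ^ 2)
      (ae_of_all _ fun ω => by
        rw [Real.norm_of_nonneg (sq_nonneg _)]
        exact pow_le_pow_left₀ (hZ0 i ω) (hZy i ω) 2)
  have hexp : ∀ (i) (s : ℝ), Integrable (fun ω => Real.exp (s * Z i ω)) P := fun i s =>
    Integrable.of_bound ((hZm i).const_mul s).exp.aestronglyMeasurable (Real.exp (|s| * y))
      (ae_of_all _ fun ω => by
        rw [Real.norm_of_nonneg (Real.exp_pos _).le, Real.exp_le_exp]
        calc s * Z i ω ≤ |s| * Z i ω := mul_le_mul_of_nonneg_right (le_abs_self s) (hZ0 i ω)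
          _ ≤ |s| * y := mul_le_mul_of_nonneg_left (hZy i ω) (abs_nonneg s))
  have hexpS : ∀ s : ℝ, Integrable (fun ω => Real.exp (s * ∑ i, Z i ω)) P := fun s =>
    Integrable.of_bound
      ((Finset.measurable_sum _ fun i _ => hZm i).const_mul s).exp.aestronglyMeasurable
      (Real.exp (|s| * ∑ _i : ι, y))
      (ae_of_all _ fun ω => by
        rw [Real.norm_of_nonneg (Real.exp_pos _).le, Real.exp_le_exp]
        calc s * ∑ i, Z i ω ≤ |s| * ∑ i, Z i ω :=
              mul_le_mul_of_nonneg_right (le_abs_self s) (Finset.sum_nonneg fun i _ => hZ0 i ω)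
          _ ≤ |s| * ∑ _i : ι, y :=
              mul_le_mul_of_nonneg_left (Finset.sum_le_sum fun i _ => hZy i ω) (abs_nonneg s))
  set m := ∑ i, ∫ ω, Z i ω ∂P with hm
  set V := (∑ i, ∫ ω, Z i ω ^ 2 ∂P) with hV
  have hb : ∀ s : ℝ, mgf (fun ω => ∑ i, Z i ω) P s
      ≤ Real.exp (s * m + V * (2 * Real.exp (2 * (|s| * y)) / y ^ 2)) := by
    intro s
    refine (hmgf s).trans ?_
    rw [hm, hV, Finset.mul_sum, Finset.sum_mul, ← Finset.sum_add_distrib, Real.exp_sum]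
    refine Finset.prod_le_prod (fun i _ => mgf_nonneg) fun i _ => ?_
    refine le_trans ?_ (Real.add_one_le_exp _)
    have : mgf (Z i) P s ≤ ∫ ω, (1 + s * Z i ω
        + Z i ω ^ 2 * (2 * Real.exp (2 * (|s| * y)) / y ^ 2)) ∂P :=
      integral_mono (hexp i s)
        (((integrable_const _).add ((hZi i).const_mul s)).add ((hZ2 i).mul_const _))
        fun ω => exp_mul_le_one_add_mul_add hy (hZ0 i ω) (hZy i ω) s
    refine this.trans (le_of_eq ?_)
    rw [integral_add (f := fun ω => 1 + s * Z i ω)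
        ((integrable_const _).add ((hZi i).const_mul s)) ((hZ2 i).mul_const _),
      integral_add (integrable_const _) ((hZi i).const_mul s), integral_const_mul,
      integral_mul_const]
    simp only [integral_const, probReal_univ, smul_eq_mul, mul_one]
    ring
  have hsub : {ω | x ≤ |∑ i, (Z i ω - ∫ ω', Z i ω' ∂P)|}
      ⊆ {ω | m + x ≤ ∑ i, Z i ω} ∪ {ω | ∑ i, Z i ω ≤ m - x} := by
    intro ω hω
    simp only [Set.mem_ofPred_eq, Finset.sum_sub_distrib] at hω
    rcases le_abs.1 hω with h | h
    · left
      simp only [Set.mem_ofPred_eq]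
      linarith
    · right
      simp only [Set.mem_ofPred_eq]
      linarith
  refine (measureReal_mono hsub).trans ((measureReal_union_le _ _).trans ?_)
  have hu := measure_ge_le_exp_mul_mgf (μ := P) (X := fun ω => ∑ i, Z i ω) (m + x) ht (hexpS t)
  have hl := measure_le_le_exp_mul_mgf (μ := P) (X := fun ω => ∑ i, Z i ω) (t := -t) (m - x)
    (by linarith) (hexpS (-t))
  have hu' := hu.trans (mul_le_mul_of_nonneg_left (hb t) (Real.exp_pos _).le)
  have hl' := hl.trans (mul_le_mul_of_nonneg_left (hb (-t)) (Real.exp_pos _).le)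
  rw [← Real.exp_add, abs_of_nonneg ht] at hu'
  rw [← Real.exp_add, abs_neg, abs_of_nonneg ht] at hl'
  have e1 : ∀ R : ℝ, -t * (m + x) + (t * m + R) = -(t * x) + R := fun R => by ring
  have e2 : ∀ R : ℝ, -(-t) * (m - x) + (-t * m + R) = -(t * x) + R := fun R => by ring
  rw [e1] at hu'
  rw [e2] at hl'
  linarith

theorem tsum_div_comp_eq (f : ℕ → ℝ≥0∞) {N : ℕ} (hN : N ≠ 0) :
    ∑' n, f (n / N) = N * ∑' q, f q := by
  have : NeZero N := ⟨hN⟩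
  rw [← (Nat.divModEquiv N).symm.tsum_eq]
  have h1 : ∀ c : ℕ × Fin N, f ((Nat.divModEquiv N).symm c / N) = f c.1 := by
    intro c
    congr 1
    have := congrArg Prod.fst ((Nat.divModEquiv N).apply_symm_apply c)
    simpa [Nat.divModEquiv] using this
  simp_rw [h1]
  rw [ENNReal.tsum_prod']
  simp [ENNReal.tsum_mul_left]

/-- The series `∑ min(x / n ^ (1 / β), 1) ^ α` is `O(1 + x ^ β)`: there are `N` terms with `n` in
one block `[qN, qN + N)`, where `N` is comparable to `1 + x ^ β`, and for `q ≥ 1` each of them is at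
most `q ^ (-α / β)`. -/
theorem exists_tsum_min_rpow_le {α β : ℝ} (hβ : 0 < β) (hαβ : β < α) :
    ∃ C : ℝ≥0, ∀ x : ℝ, 0 ≤ x →
      ∑' n : ℕ, ENNReal.ofReal (min (x / (n : ℝ) ^ (1 / β)) 1 ^ α)
        ≤ C * ENNReal.ofReal (1 + x ^ β) := by
  have hα : 0 < α := hβ.trans hαβ
  have hs : 1 < α / β := (one_lt_div hβ).2 hαβ
  set f : ℕ → ℝ≥0∞ := fun q => ENNReal.ofReal ((q : ℝ) ^ (-(α / β))) + if q = 0 then 1 else 0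
    with hf
  have hfsum : ∑' q, f q ≠ ∞ := by
    rw [hf, ENNReal.tsum_add, tsum_ite_eq]
    refine ENNReal.add_ne_top.2 ⟨?_, ENNReal.one_ne_top⟩
    exact (Real.summable_nat_rpow.2 (by linarith)).tsum_ofReal_ne_top
  refine ⟨2 * (∑' q, f q).toNNReal, fun x hx => ?_⟩
  set N := ⌈x ^ β⌉₊ + 1 with hN
  have hxN : x ^ β ≤ N := by
    rw [hN]; push_cast
    exact (Nat.le_ceil _).trans (by linarith)
  have hN0 : (0 : ℝ) < N := by rw [hN]; positivity
  have hterm : ∀ n : ℕ, ENNReal.ofReal (min (x / (n : ℝ) ^ (1 / β)) 1 ^ α) ≤ f (n / N) := by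
    intro n
    have hmin0 : 0 ≤ min (x / (n : ℝ) ^ (1 / β)) 1 := le_min (by positivity) zero_le_one
    by_cases hq : n / N = 0
    · rw [hf]
      simp only [hq, if_true]
      refine le_add_left ?_
      rw [ENNReal.ofReal_le_one]
      exact Real.rpow_le_one hmin0 (min_le_right _ _) hα.le
    · rw [hf]
      simp only [hq, if_false, add_zero]
      refine ENNReal.ofReal_le_ofReal ?_
      set q := n / N with hqdef
      have hq0 : (0 : ℝ) < q := by exact_mod_cast Nat.pos_of_ne_zero hq
      have hqn : (q : ℝ) * N ≤ n := by exact_mod_cast Nat.div_mul_le_self n N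
      have hn0 : (0 : ℝ) < n := lt_of_lt_of_le (mul_pos hq0 hN0) hqn
      have h1 : x ≤ (N : ℝ) ^ (1 / β) := by
        rw [one_div, Real.le_rpow_inv_iff_of_pos hx hN0.le hβ]; exact hxN
      have h2 : x / (n : ℝ) ^ (1 / β) ≤ (q : ℝ) ^ (-(1 / β)) := by
        rw [div_le_iff₀ (by positivity), Real.rpow_neg hq0.le, ← div_eq_inv_mul,
          ← Real.div_rpow hn0.le hq0.le]
        refine h1.trans (Real.rpow_le_rpow hN0.le ?_ (by positivity))
        rw [le_div_iff₀ hq0]; linarith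
      calc min (x / (n : ℝ) ^ (1 / β)) 1 ^ α ≤ ((q : ℝ) ^ (-(1 / β))) ^ α :=
            Real.rpow_le_rpow hmin0 ((min_le_left _ _).trans h2) hα.le
        _ = (q : ℝ) ^ (-(α / β)) := by
            rw [← Real.rpow_mul hq0.le]; congr 1; ring
  refine (ENNReal.tsum_le_tsum hterm).trans ?_
  rw [tsum_div_comp_eq f (by omega), mul_comm]
  push_cast
  rw [ENNReal.coe_toNNReal hfsum, mul_comm (2 : ℝ≥0∞), mul_assoc]
  gcongr
  rw [← ENNReal.ofReal_natCast, ← ENNReal.ofReal_ofNat, ← ENNReal.ofReal_mul (by norm_num)]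
  refine ENNReal.ofReal_le_ofReal ?_
  have h3 := Nat.ceil_lt_add_one (Real.rpow_nonneg hx β)
  rw [hN]; push_cast
  have := Real.rpow_nonneg hx β
  linarith

theorem sq_le_one_add_rpow {x s : ℝ} (hx : 0 ≤ x) (hs : 2 ≤ s) : x ^ 2 ≤ 1 + x ^ s := by
  rcases le_total x 1 with h | h
  · have := Real.rpow_nonneg hx s
    nlinarith
  · have := Real.rpow_le_rpow_of_exponent_le h hs
    rw [Real.rpow_two] at this
    linarith

theorem le_one_add_rpow {x s : ℝ} (hx : 0 ≤ x) (hs : 1 ≤ s) : x ≤ 1 + x ^ s := by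
  rcases le_total x 1 with h | h
  · have := Real.rpow_nonneg hx s
    linarith
  · have := Real.rpow_le_rpow_of_exponent_le h hs
    rw [Real.rpow_one] at this
    linarith

/-- After truncation at `n ^ (1 / β)` the second moment of a variable with finite `β`-th moment is
smaller than `n ^ (2 / p - 1)` by a power of `n`. For `β ≥ 2` this uses `p < 2`, and for `β < 2` it
uses `2 / p - 2 / β = 2 / α`. -/
theorem exists_min_sq_le {p α β : ℝ} (hp : 0 < p) (hp2 : p < 2) (hα : 0 < α) (hβ : 0 < β)
    (hαβ : α⁻¹ + β⁻¹ = p⁻¹) :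
    ∃ γ > 0, ∀ n : ℕ, 1 ≤ n → ∀ x : ℝ, 0 ≤ x →
      min x ((n : ℝ) ^ (1 / β)) ^ 2 ≤ (1 + x ^ β) * (n : ℝ) ^ (2 / p - 1 - γ) := by
  rcases le_total 2 β with h | h
  · refine ⟨2 / p - 1, by rw [gt_iff_lt, sub_pos, lt_div_iff₀ hp]; linarith,
      fun n hn x hx => ?_⟩
    rw [sub_self, Real.rpow_zero, mul_one]
    exact (pow_le_pow_left₀ (le_min hx (by positivity)) (min_le_left _ _) 2).trans
      (sq_le_one_add_rpow hx h)
  · refine ⟨2 / α, by positivity, fun n hn x hx => ?_⟩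
    have hn0 : (0 : ℝ) < n := by exact_mod_cast hn
    have hm0 : 0 ≤ min x ((n : ℝ) ^ (1 / β)) := le_min hx (by positivity)
    have e : 2 / p - 1 - 2 / α = 1 / β * (2 - β) := by
      have : 2 / p = 2 / α + 2 / β := by
        rw [div_eq_mul_inv, ← hαβ]; ring
      rw [this]; field_simp; ring
    rw [e, Real.rpow_mul hn0.le]
    calc min x ((n : ℝ) ^ (1 / β)) ^ 2
        = min x ((n : ℝ) ^ (1 / β)) ^ β * min x ((n : ℝ) ^ (1 / β)) ^ (2 - β) := by
          rw [← Real.rpow_add' hm0 (by norm_num), ← Real.rpow_two]; congr 1; ring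
      _ ≤ (1 + x ^ β) * ((n : ℝ) ^ (1 / β)) ^ (2 - β) := by
          refine mul_le_mul ?_ ?_ (by positivity) (by positivity)
          · have := Real.rpow_le_rpow hm0 (min_le_left x ((n : ℝ) ^ (1 / β))) hβ.le
            linarith
          · exact Real.rpow_le_rpow hm0 (min_le_right _ _) (by linarith)

/-! ### Weighted samples and truncated summands -/

/-- The first Borel–Cantelli lemma with a summable bound that is only eventually valid. -/
theorem ae_eventually_notMem_of_eventually_le {Ω : Type*} [MeasurableSpace Ω] {P : Measure Ω}
    {s : ℕ → Set Ω} {r : ℕ → ℝ≥0∞} (hs : ∀ᶠ n in atTop, P (s n) ≤ r n) (hr : ∑' n, r n ≠ ∞) :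
    ∀ᵐ ω ∂P, ∀ᶠ n in atTop, ω ∉ s n := by
  classical
  have h1 : ∑' n, P (if P (s n) ≤ r n then s n else ∅) ≠ ∞ := by
    refine ne_top_of_le_ne_top hr (ENNReal.tsum_le_tsum fun n => ?_)
    split_ifs with h
    · exact h
    · simp
  filter_upwards [ae_eventually_notMem h1] with ω hω
  filter_upwards [hω, hs] with n h2 h3
  rwa [if_pos h3] at h2

theorem eventually_forall_lt_le {x a : ℕ → ℝ} (ha : Monotone a) (hat : Tendsto a atTop atTop)
    (h : ∀ᶠ j in atTop, x j ≤ a j) : ∀ᶠ n in atTop, ∀ j < n, x j ≤ a n := by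
  obtain ⟨J, hJ⟩ := eventually_atTop.1 h
  have h1 : ∀ᶠ n in atTop, ∀ j ∈ Finset.range J, x j ≤ a n :=
    (Finset.eventually_all _).2 fun j _ => hat.eventually_ge_atTop (x j)
  filter_upwards [h1] with n hn j hj
  rcases lt_or_ge j J with hjJ | hjJ
  · exact hn j (Finset.mem_range.2 hjJ)
  · exact (hJ j hjJ).trans (ha hj.le)

/-- Independent and identically distributed `X 0, X 1, …` together with a triangular array `W` of
weights whose rows are negatively orthant dependent and independent of `X`, under the moment
conditions on the weights in the Marcinkiewicz–Zygmund law with exponents `p`, `α`, `β`. -/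
structure IsWeightedSample {Ω : Type*} [MeasurableSpace Ω] (P : Measure Ω) (X : ℕ → Ω → ℝ)
    (W : (n : ℕ) → Fin n → Ω → ℝ) (p α β : ℝ) : Prop where
  measurable_sample : ∀ i, Measurable (X i)
  iIndepFun_sample : iIndepFun X P
  identDistrib_sample : ∀ i, IdentDistrib (X i) (X 0) P P
  measurable_weight : ∀ n j, Measurable (W n j)
  isNOD_weight : ∀ n, IsNOD (W n) P
  indepFun : ∀ n, IndepFun (fun (ω : Ω) (j : Fin n) => W n j ω) (fun (ω : Ω) (i : ℕ) => X i ω) P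
  one_le : 1 ≤ p
  lt_two : p < 2
  two_mul_lt : 2 * p < α
  one_lt : 1 < β
  inv_add_inv : α⁻¹ + β⁻¹ = p⁻¹
  weight_rpow : ∃ C : ℝ≥0, ∀ᶠ n : ℕ in atTop,
      ∑ j : Fin n, ∫⁻ ω, ‖W n j ω‖ₑ ^ α ∂P ≤ (C : ℝ≥0∞) * (n : ℝ≥0∞)
  weight_one : ∃ C : ℝ≥0, ∀ᶠ n : ℕ in atTop,
      ∑ j : Fin n, ∫⁻ ω, ‖W n j ω‖ₑ ∂P ≤ (C : ℝ≥0∞) * (n : ℝ≥0∞) ^ (1 / p)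

/-- A continuous monotone or antitone function `g` with `0 ≤ g w ≤ |w|`; the examples are the
positive and the negative part. -/
structure IsMonotonePart (g : ℝ → ℝ) : Prop where
  continuous : Continuous g
  nonneg : ∀ w, 0 ≤ g w
  le_abs : ∀ w, g w ≤ |w|
  monotone_or : Monotone g ∨ Antitone g

/-- The product `g w * h x` with the factor `h x` truncated at `a` and the result truncated at
`y`. -/
def truncMul (g h : ℝ → ℝ) (a y w x : ℝ) : ℝ := min (g w * min (h x) a) y

section truncMul

variable {g h : ℝ → ℝ} {a y : ℝ}

theorem truncMul_nonneg (hg : IsMonotonePart g) (hh : ∀ x, 0 ≤ h x) (ha : 0 ≤ a) (hy : 0 ≤ y)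
    (w x : ℝ) : 0 ≤ truncMul g h a y w x :=
  le_min (mul_nonneg (hg.nonneg w) (le_min (hh x) ha)) hy

theorem truncMul_le (w x : ℝ) : truncMul g h a y w x ≤ y := min_le_right _ _

theorem measurable_truncMul (hg : IsMonotonePart g) (hh : Measurable h) :
    Measurable (Function.uncurry (truncMul g h a y)) :=
  (((hg.continuous.measurable.comp measurable_fst).mul
    ((hh.comp measurable_snd).min measurable_const)).min measurable_const)

theorem continuous_truncMul (hg : IsMonotonePart g) (x : ℝ) :
    Continuous fun w => truncMul g h a y w x :=
  (hg.continuous.mul continuous_const).min continuous_const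

theorem monotone_or_antitone_truncMul (hg : IsMonotonePart g) (hh : ∀ x, 0 ≤ h x) (ha : 0 ≤ a) :
    (∀ x, Monotone fun w => truncMul g h a y w x) ∨
      ∀ x, Antitone fun w => truncMul g h a y w x := by
  refine hg.monotone_or.imp (fun H x u v huv => ?_) (fun H x u v huv => ?_)
  · exact min_le_min_right _ (mul_le_mul_of_nonneg_right (H huv) (le_min (hh x) ha))
  · exact min_le_min_right _ (mul_le_mul_of_nonneg_right (H huv) (le_min (hh x) ha))

end truncMul

namespace IsWeightedSample

variable {Ω : Type*} [MeasurableSpace Ω] {P : Measure Ω} {X : ℕ → Ω → ℝ}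
  {W : (n : ℕ) → Fin n → Ω → ℝ} {p α β : ℝ}

theorem p_pos (M : IsWeightedSample P X W p α β) : 0 < p := lt_of_lt_of_le one_pos M.one_le

theorem two_lt_alpha (M : IsWeightedSample P X W p α β) : 2 < α := by
  have := M.one_le
  have := M.two_mul_lt
  linarith

theorem alpha_pos (M : IsWeightedSample P X W p α β) : 0 < α := by
  linarith [M.two_lt_alpha]

theorem beta_pos (M : IsWeightedSample P X W p α β) : 0 < β := one_pos.trans M.one_lt

theorem beta_lt_alpha (M : IsWeightedSample P X W p α β) : β < α := by
  have h1 := M.inv_add_inv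
  have h2 : α⁻¹ < (2 * p)⁻¹ := inv_strictAnti₀ (by linarith [M.p_pos]) M.two_mul_lt
  rw [mul_inv] at h2
  have h3 : α⁻¹ < β⁻¹ := by
    have := inv_pos.2 M.p_pos
    linarith
  exact (inv_lt_inv₀ M.alpha_pos M.beta_pos).1 h3

theorem indepFun_weight_sample (M : IsWeightedSample P X W p α β) (n : ℕ) (j : Fin n) :
    IndepFun (W n j) (X j) P :=
  (M.indepFun n).comp (φ := fun w : Fin n → ℝ => w j) (ψ := fun x : ℕ → ℝ => x j)
    (measurable_pi_apply _) (measurable_pi_apply _)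

theorem lintegral_comp_sample (M : IsWeightedSample P X W p α β) {ψ : ℝ → ℝ≥0∞}
    (hψ : Measurable ψ) (j : ℕ) : ∫⁻ ω, ψ (X j ω) ∂P = ∫⁻ ω, ψ (X 0 ω) ∂P :=
  ((M.identDistrib_sample j).comp hψ).lintegral_eq

/-- Expectations of products of functions of weights and sample values factor, and the sample values
have a common law. -/
theorem sum_lintegral_mul (M : IsWeightedSample P X W p α β) {φ ψ : ℝ → ℝ≥0∞}
    (hφ : Measurable φ) (hψ : Measurable ψ) (n : ℕ) :
    ∑ j : Fin n, ∫⁻ ω, φ (W n j ω) * ψ (X j ω) ∂P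
      = (∑ j : Fin n, ∫⁻ ω, φ (W n j ω) ∂P) * ∫⁻ ω, ψ (X 0 ω) ∂P := by
  rw [Finset.sum_mul]
  refine Finset.sum_congr rfl fun j _ => ?_
  rw [← M.lintegral_comp_sample hψ j]
  exact lintegral_mul_eq_lintegral_mul_lintegral_of_indepFun (hφ.comp (M.measurable_weight n j))
    (hψ.comp (M.measurable_sample j)) ((M.indepFun_weight_sample n j).comp hφ hψ)

/-- The exponential moments of a sum of truncated products, for `t` of either sign: the exponentials
are monotone or antitone functions of the weights. -/
theorem mgf_sum_truncMul_le [IsProbabilityMeasure P] (M : IsWeightedSample P X W p α β)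
    {g h : ℝ → ℝ} (hg : IsMonotonePart g) (hhm : Measurable h) (hh : ∀ x, 0 ≤ h x) {a y : ℝ}
    (ha : 0 ≤ a) (hy : 0 ≤ y) (n : ℕ) (t : ℝ) :
    mgf (fun ω => ∑ j : Fin n, truncMul g h a y (W n j ω) (X j ω)) P t
      ≤ ∏ j : Fin n, mgf (fun ω => truncMul g h a y (W n j ω) (X j ω)) P t := by
  have hZm : ∀ j : Fin n, Measurable fun ω => truncMul g h a y (W n j ω) (X j ω) := fun j =>
    (measurable_truncMul hg hhm).comp ((M.measurable_weight n j).prodMk (M.measurable_sample j))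
  have hb : ∀ w x, Real.exp (t * truncMul g h a y w x) ≤ Real.exp (|t| * y) := fun w x => by
    rw [Real.exp_le_exp]
    exact (mul_le_mul_of_nonneg_right (le_abs_self t) (truncMul_nonneg hg hh ha hy w x)).trans
      (mul_le_mul_of_nonneg_left (truncMul_le w x) (abs_nonneg t))
  have hint : ∀ j : Fin n,
      Integrable (fun ω => Real.exp (t * truncMul g h a y (W n j ω) (X j ω))) P := fun j =>
    Integrable.of_bound ((hZm j).const_mul t).exp.aestronglyMeasurable (Real.exp (|t| * y))
      (ae_of_all _ fun ω => by
        rw [Real.norm_of_nonneg (Real.exp_pos _).le]; exact hb _ _)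
  have hexp : ∀ ω, Real.exp (t * ∑ j : Fin n, truncMul g h a y (W n j ω) (X j ω))
      = ∏ j : Fin n, Real.exp (t * truncMul g h a y (W n j ω) (X j ω)) := fun ω => by
    rw [Finset.mul_sum, Real.exp_sum]
  have hmeasprod : Measurable fun ω =>
      ∏ j : Fin n, Real.exp (t * truncMul g h a y (W n j ω) (X j ω)) :=
    Finset.measurable_prod _ fun j _ => ((hZm j).const_mul t).exp
  have hintS : Integrable (fun ω =>
      ∏ j : Fin n, Real.exp (t * truncMul g h a y (W n j ω) (X j ω))) P :=
    Integrable.of_bound hmeasprod.aestronglyMeasurable (∏ _j : Fin n, Real.exp (|t| * y))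
      (ae_of_all _ fun ω => by
        rw [Real.norm_of_nonneg (Finset.prod_nonneg fun j _ => (Real.exp_pos _).le)]
        exact Finset.prod_le_prod (fun j _ => (Real.exp_pos _).le) fun j _ => hb _ _)
  have key := (M.isNOD_weight n).lintegral_prod_le_of_indepFun (M.measurable_weight n)
    (X := fun j : Fin n => X j) (fun j => M.measurable_sample j)
    (M.iIndepFun_sample.precomp Fin.val_injective)
    ((M.indepFun n).comp (φ := id) (ψ := fun (x : ℕ → ℝ) (j : Fin n) => x j) measurable_id
      (measurable_pi_lambda _ fun j => measurable_pi_apply _))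
    (f := fun w x => Real.exp (t * truncMul g h a y w x))
    ((measurable_truncMul hg hhm).const_mul t).exp
    (fun x => ((continuous_truncMul hg x).const_mul t).rexp)
    (fun w x => (Real.exp_pos _).le) ?_
  · have h1 : ENNReal.ofReal (mgf (fun ω => ∑ j : Fin n, truncMul g h a y (W n j ω) (X j ω)) P t)
        = ∫⁻ ω, ∏ j : Fin n, ENNReal.ofReal
          (Real.exp (t * truncMul g h a y (W n j ω) (X j ω))) ∂P := by
      simp only [mgf]
      simp_rw [hexp]
      rw [ofReal_integral_eq_lintegral_ofReal hintS
        (ae_of_all _ fun ω => Finset.prod_nonneg fun j _ => (Real.exp_pos _).le)]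
      refine lintegral_congr fun ω => ?_
      rw [ENNReal.ofReal_prod_of_nonneg fun j _ => (Real.exp_pos _).le]
    have h2 : ENNReal.ofReal
        (∏ j : Fin n, mgf (fun ω => truncMul g h a y (W n j ω) (X j ω)) P t)
        = ∏ j : Fin n, ∫⁻ ω, ENNReal.ofReal
          (Real.exp (t * truncMul g h a y (W n j ω) (X j ω))) ∂P := by
      rw [ENNReal.ofReal_prod_of_nonneg fun j _ => mgf_nonneg]
      refine Finset.prod_congr rfl fun j _ => ?_
      simp only [mgf]
      rw [ofReal_integral_eq_lintegral_ofReal (hint j)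
        (ae_of_all _ fun ω => (Real.exp_pos _).le)]
    rw [← ENNReal.ofReal_le_ofReal_iff (Finset.prod_nonneg fun j _ => mgf_nonneg), h1, h2]
    exact key
  · rcases monotone_or_antitone_truncMul (y := y) hg hh ha with H | H <;>
      rcases le_total 0 t with ht | ht
    · exact Or.inl fun x u v huv => Real.exp_le_exp.2 (mul_le_mul_of_nonneg_left (H x huv) ht)
    · exact Or.inr fun x u v huv => Real.exp_le_exp.2 (mul_le_mul_of_nonpos_left (H x huv) ht)
    · exact Or.inr fun x u v huv => Real.exp_le_exp.2 (mul_le_mul_of_nonneg_left (H x huv) ht)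
    · exact Or.inl fun x u v huv => Real.exp_le_exp.2 (mul_le_mul_of_nonpos_left (H x huv) ht)

theorem lintegral_one_add_rpow_ne_top [IsProbabilityMeasure P] {h : ℝ → ℝ}
    (hh : ∀ x, 0 ≤ h x) (hβ : ∫⁻ ω, ENNReal.ofReal (h (X 0 ω) ^ β) ∂P ≠ ∞) :
    ∫⁻ ω, ENNReal.ofReal (1 + h (X 0 ω) ^ β) ∂P ≠ ∞ := by
  have : ∀ ω, ENNReal.ofReal (1 + h (X 0 ω) ^ β) = 1 + ENNReal.ofReal (h (X 0 ω) ^ β) :=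
    fun ω => by rw [ENNReal.ofReal_add zero_le_one (Real.rpow_nonneg (hh _) _),
      ENNReal.ofReal_one]
  simp_rw [this]
  rw [lintegral_add_left measurable_const]
  simpa using hβ

/-- The second moments of the truncated summands grow with a power strictly below `2 / p`. -/
theorem exists_sum_integral_sq_le [IsProbabilityMeasure P] (M : IsWeightedSample P X W p α β)
    {g h : ℝ → ℝ} (hg : IsMonotonePart g) (hhm : Measurable h) (hh : ∀ x, 0 ≤ h x)
    (hβ : ∫⁻ ω, ENNReal.ofReal (h (X 0 ω) ^ β) ∂P ≠ ∞) :
    ∃ γ > 0, ∃ K : ℝ, 0 ≤ K ∧ ∀ᶠ n : ℕ in atTop, ∀ y : ℝ, 0 ≤ y →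
      ∑ j : Fin n, ∫ ω, truncMul g h ((n : ℝ) ^ (1 / β)) y (W n j ω) (X j ω) ^ 2 ∂P
        ≤ K * (n : ℝ) ^ (2 / p - γ) := by
  obtain ⟨γ, hγ, hsq⟩ := exists_min_sq_le M.p_pos M.lt_two M.alpha_pos M.beta_pos M.inv_add_inv
  obtain ⟨C, hC⟩ := M.weight_rpow
  set K0 := ∫⁻ ω, ENNReal.ofReal (1 + h (X 0 ω) ^ β) ∂P with hK0
  have hK0t : K0 ≠ ∞ := lintegral_one_add_rpow_ne_top hh hβ
  refine ⟨γ, hγ, (1 + C) * K0.toReal, by positivity, ?_⟩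
  filter_upwards [hC, eventually_ge_atTop 1] with n hn hn1 y hy
  have hn0 : (0 : ℝ) < n := by exact_mod_cast hn1
  set a := (n : ℝ) ^ (1 / β) with ha
  have ha0 : 0 ≤ a := by positivity
  set κ := 2 / p - 1 - γ with hκ
  have hZm : ∀ j : Fin n, Measurable fun ω => truncMul g h a y (W n j ω) (X j ω) := fun j =>
    (measurable_truncMul hg hhm).comp ((M.measurable_weight n j).prodMk (M.measurable_sample j))
  have hint : ∀ j : Fin n, Integrable (fun ω => truncMul g h a y (W n j ω) (X j ω) ^ 2) P :=
    fun j => Integrable.of_bound ((hZm j).pow_const 2).aestronglyMeasurable (y ^ 2)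
      (ae_of_all _ fun ω => by
        rw [Real.norm_of_nonneg (sq_nonneg _)]
        exact pow_le_pow_left₀ (truncMul_nonneg hg hh ha0 hy _ _) (truncMul_le _ _) 2)
  have hpt : ∀ w x, ENNReal.ofReal (truncMul g h a y w x ^ 2)
      ≤ (1 + ‖w‖ₑ ^ α) * ENNReal.ofReal ((1 + h x ^ β) * (n : ℝ) ^ κ) := by
    intro w x
    have e1 : (1 + ‖w‖ₑ ^ α) = ENNReal.ofReal (1 + |w| ^ α) := by
      rw [Real.enorm_eq_ofReal_abs, ENNReal.ofReal_rpow_of_nonneg (abs_nonneg w) M.alpha_pos.le,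
        ENNReal.ofReal_add zero_le_one (by positivity), ENNReal.ofReal_one]
    rw [e1, ← ENNReal.ofReal_mul (by positivity)]
    refine ENNReal.ofReal_le_ofReal ?_
    have h1 : truncMul g h a y w x ≤ |w| * min (h x) a :=
      (min_le_left _ _).trans (mul_le_mul_of_nonneg_right (hg.le_abs w) (le_min (hh x) ha0))
    calc truncMul g h a y w x ^ 2 ≤ (|w| * min (h x) a) ^ 2 :=
          pow_le_pow_left₀ (truncMul_nonneg hg hh ha0 hy _ _) h1 2
      _ = |w| ^ 2 * min (h x) a ^ 2 := mul_pow _ _ _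
      _ ≤ _ := mul_le_mul (sq_le_one_add_rpow (abs_nonneg w) M.two_lt_alpha.le)
          (hsq n hn1 _ (hh x)) (sq_nonneg _) (by positivity)
  have hmain : ∑ j : Fin n, ∫⁻ ω, ENNReal.ofReal
      (truncMul g h a y (W n j ω) (X j ω) ^ 2) ∂P
      ≤ ((1 + C) * n) * (K0 * ENNReal.ofReal ((n : ℝ) ^ κ)) := by
    calc _ ≤ ∑ j : Fin n, ∫⁻ ω, (1 + ‖W n j ω‖ₑ ^ α)
            * ENNReal.ofReal ((1 + h (X j ω) ^ β) * (n : ℝ) ^ κ) ∂P :=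
          Finset.sum_le_sum fun j _ => lintegral_mono fun ω => hpt _ _
      _ = (∑ j : Fin n, ∫⁻ ω, (1 + ‖W n j ω‖ₑ ^ α) ∂P)
            * ∫⁻ ω, ENNReal.ofReal ((1 + h (X 0 ω) ^ β) * (n : ℝ) ^ κ) ∂P :=
          M.sum_lintegral_mul (φ := fun w => 1 + ‖w‖ₑ ^ α)
            (ψ := fun x => ENNReal.ofReal ((1 + h x ^ β) * (n : ℝ) ^ κ))
            (measurable_const.add (measurable_enorm.pow_const α))
            (((hhm.pow_const β).const_add 1).mul_const _).ennreal_ofReal n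
      _ ≤ _ := by
          have e2 : ∫⁻ ω, ENNReal.ofReal ((1 + h (X 0 ω) ^ β) * (n : ℝ) ^ κ) ∂P
              = K0 * ENNReal.ofReal ((n : ℝ) ^ κ) := by
            rw [hK0, ← lintegral_mul_const]
            · refine lintegral_congr fun ω => ?_
              have := Real.rpow_nonneg (hh (X 0 ω)) β
              rw [ENNReal.ofReal_mul (by positivity)]
            · exact (((hhm.comp (M.measurable_sample 0)).pow_const β).const_add 1).ennreal_ofReal
          rw [e2]
          gcongr
          have e3 : ∀ j : Fin n, ∫⁻ ω, (1 + ‖W n j ω‖ₑ ^ α) ∂P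
              = 1 + ∫⁻ ω, ‖W n j ω‖ₑ ^ α ∂P := fun j => by
            rw [lintegral_add_left measurable_const]; simp
          simp_rw [e3]
          rw [Finset.sum_add_distrib, add_mul]
          simpa using hn
  rw [← ENNReal.ofReal_le_ofReal_iff (by positivity),
    ENNReal.ofReal_sum_of_nonneg fun j _ => integral_nonneg fun ω => sq_nonneg _]
  have e4 : ∀ j : Fin n,
      ENNReal.ofReal (∫ ω, truncMul g h a y (W n j ω) (X j ω) ^ 2 ∂P)
        = ∫⁻ ω, ENNReal.ofReal (truncMul g h a y (W n j ω) (X j ω) ^ 2) ∂P := fun j =>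
    ofReal_integral_eq_lintegral_ofReal (hint j) (ae_of_all _ fun ω => sq_nonneg _)
  simp_rw [e4]
  refine hmain.trans (le_of_eq ?_)
  have e5 : (n : ℝ) ^ (2 / p - γ) = n * (n : ℝ) ^ κ := by
    rw [show 2 / p - γ = 1 + κ by rw [hκ]; ring, Real.rpow_add hn0, Real.rpow_one]
  rw [e5, ENNReal.ofReal_mul (by positivity), ENNReal.ofReal_mul (by positivity),
    ENNReal.ofReal_mul (by positivity), ENNReal.ofReal_toReal hK0t, ENNReal.ofReal_natCast,
    ENNReal.ofReal_add zero_le_one C.coe_nonneg, ENNReal.ofReal_one]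
  have : ENNReal.ofReal (C : ℝ) = C := ENNReal.ofReal_coe_nnreal
  rw [this]
  ring

end IsWeightedSample

/-! ### Deviations of the truncated sums and removal of the truncation -/

namespace IsWeightedSample

variable {Ω : Type*} [MeasurableSpace Ω] {P : Measure Ω} {X : ℕ → Ω → ℝ}
  {W : (n : ℕ) → Fin n → Ω → ℝ} {p α β : ℝ}

/-- Almost surely the centred truncated sums are eventually smaller than `δ * n ^ (1 / p)`, if the
truncation level `ε * n ^ (1 / p)` is a small enough multiple of `n ^ (1 / p)`. -/
theorem exists_ae_eventually_abs_sum_sub_lt [IsProbabilityMeasure P]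
    (M : IsWeightedSample P X W p α β)
    {g h : ℝ → ℝ} (hg : IsMonotonePart g) (hhm : Measurable h) (hh : ∀ x, 0 ≤ h x)
    (hβ : ∫⁻ ω, ENNReal.ofReal (h (X 0 ω) ^ β) ∂P ≠ ∞) {δ : ℝ} (hδ : 0 < δ) :
    ∃ ε > 0, ∀ᵐ ω ∂P, ∀ᶠ n : ℕ in atTop,
      |∑ j : Fin n,
        (truncMul g h ((n : ℝ) ^ (1 / β)) (ε * (n : ℝ) ^ (1 / p)) (W n j ω) (X j ω)
          - ∫ ω', truncMul g h ((n : ℝ) ^ (1 / β)) (ε * (n : ℝ) ^ (1 / p))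
            (W n j ω') (X j ω') ∂P)| < δ * (n : ℝ) ^ (1 / p) := by
  obtain ⟨γ, hγ, K, hK0, hK⟩ := M.exists_sum_integral_sq_le hg hhm hh hβ
  -- With `t = γ log n / (2 ε n ^ (1 / p))` the variance term of the exponential bound stays
  -- bounded, and this `ε` makes the linear term equal to `-2 log n`.
  set ε := γ * δ / 4 with hε
  have hε0 : 0 < ε := by positivity
  refine ⟨ε, hε0, ?_⟩
  have hr : ∑' n : ℕ, ENNReal.ofReal (2 * Real.exp (2 * K / ε ^ 2) * (n : ℝ) ^ (-2 : ℝ)) ≠ ∞ :=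
    ((Real.summable_nat_rpow.2 (by norm_num)).mul_left _).tsum_ofReal_ne_top
  have hs : ∀ᶠ n : ℕ in atTop, P {ω | δ * (n : ℝ) ^ (1 / p) ≤ |∑ j : Fin n,
        (truncMul g h ((n : ℝ) ^ (1 / β)) (ε * (n : ℝ) ^ (1 / p)) (W n j ω) (X j ω)
          - ∫ ω', truncMul g h ((n : ℝ) ^ (1 / β)) (ε * (n : ℝ) ^ (1 / p))
            (W n j ω') (X j ω') ∂P)|}
      ≤ ENNReal.ofReal (2 * Real.exp (2 * K / ε ^ 2) * (n : ℝ) ^ (-2 : ℝ)) := by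
    filter_upwards [hK, eventually_ge_atTop 1] with n hn hn1
    have hn0 : (0 : ℝ) < n := by exact_mod_cast hn1
    have hlog : 0 ≤ Real.log n := Real.log_nonneg (by exact_mod_cast hn1)
    set L := (n : ℝ) ^ (1 / p) with hL
    have hL0 : 0 < L := by positivity
    have hy0 : 0 < ε * L := by positivity
    have ha0 : 0 ≤ (n : ℝ) ^ (1 / β) := by positivity
    have hV := hn (ε * L) hy0.le
    have hB := measure_abs_sum_sub_integral_ge_le (P := P)
      (Z := fun (j : Fin n) ω => truncMul g h ((n : ℝ) ^ (1 / β)) (ε * L) (W n j ω) (X j ω))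
      hy0 (fun j => (measurable_truncMul hg hhm).comp
        ((M.measurable_weight n j).prodMk (M.measurable_sample j)))
      (fun j ω => truncMul_nonneg hg hh ha0 hy0.le _ _) (fun j ω => truncMul_le _ _)
      (M.mgf_sum_truncMul_le hg hhm hh ha0 hy0.le n)
      (t := γ * Real.log n / (2 * (ε * L))) (by positivity) (δ * L)
    rw [← ofReal_measureReal (measure_ne_top _ _)]
    refine ENNReal.ofReal_le_ofReal (hB.trans ?_)
    rw [mul_assoc]
    refine mul_le_mul_of_nonneg_left ?_ zero_le_two
    have e1 : γ * Real.log n / (2 * (ε * L)) * (δ * L) = 2 * Real.log n := by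
      rw [hε]; field_simp; ring
    have e2 : 2 * (γ * Real.log n / (2 * (ε * L)) * (ε * L)) = Real.log n * γ := by
      field_simp
    have e3 : Real.exp (Real.log n * γ) = (n : ℝ) ^ γ := (Real.rpow_def_of_pos hn0 γ).symm
    have e4 : (n : ℝ) ^ (-2 : ℝ) = Real.exp (-(2 * Real.log n)) := by
      rw [Real.rpow_def_of_pos hn0]; congr 1; ring
    have e5 : (n : ℝ) ^ (2 / p - γ) * (n : ℝ) ^ γ = L ^ 2 := by
      rw [← Real.rpow_add hn0, hL, ← Real.rpow_natCast, ← Real.rpow_mul hn0.le]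
      congr 1; push_cast; ring
    rw [e1, e2, e3, e4, mul_comm (Real.exp (2 * K / ε ^ 2)), ← Real.exp_add, Real.exp_le_exp]
    refine add_le_add_right ?_ _
    calc _ ≤ K * (n : ℝ) ^ (2 / p - γ) * (2 * (n : ℝ) ^ γ / (ε * L) ^ 2) :=
          mul_le_mul_of_nonneg_right hV (by positivity)
      _ = 2 * K * ((n : ℝ) ^ (2 / p - γ) * (n : ℝ) ^ γ) / (ε * L) ^ 2 := by ring
      _ = 2 * K / ε ^ 2 := by rw [e5]; field_simp
  filter_upwards [ae_eventually_notMem_of_eventually_le hs hr] with ω hω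
  filter_upwards [hω] with n hn
  simpa using hn

theorem tsum_lintegral_min_rpow_ne_top [IsProbabilityMeasure P]
    (M : IsWeightedSample P X W p α β) {h : ℝ → ℝ} (hhm : Measurable h) (hh : ∀ x, 0 ≤ h x)
    (hβ : ∫⁻ ω, ENNReal.ofReal (h (X 0 ω) ^ β) ∂P ≠ ∞) :
    ∑' n : ℕ, ∫⁻ ω, ENNReal.ofReal (min (h (X 0 ω) / (n : ℝ) ^ (1 / β)) 1 ^ α) ∂P ≠ ∞ := by
  obtain ⟨C, hC⟩ := exists_tsum_min_rpow_le M.beta_pos M.beta_lt_alpha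
  have hm : Measurable fun ω => h (X 0 ω) := hhm.comp (M.measurable_sample 0)
  rw [← lintegral_tsum fun n =>
    (((hm.div_const _).min measurable_const).pow_const α).ennreal_ofReal.aemeasurable]
  refine ne_top_of_le_ne_top ?_ (lintegral_mono fun ω => hC _ (hh (X 0 ω)))
  rw [lintegral_const_mul _ ((hm.pow_const β).const_add 1).ennreal_ofReal]
  exact ENNReal.mul_ne_top ENNReal.coe_ne_top (lintegral_one_add_rpow_ne_top hh hβ)

/-- The normalized `α`-th moments of the products with truncated sample values are bounded by a
constant times the terms of the convergent series in `tsum_lintegral_min_rpow_ne_top`. -/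
theorem exists_sum_lintegral_rpow_le
    (M : IsWeightedSample P X W p α β) {g h : ℝ → ℝ} (hg : IsMonotonePart g)
    (hhm : Measurable h) (hh : ∀ x, 0 ≤ h x) :
    ∃ C : ℝ≥0, ∀ᶠ n : ℕ in atTop,
      ∑ j : Fin n, ∫⁻ ω, ENNReal.ofReal
        ((g (W n j ω) * min (h (X j ω)) ((n : ℝ) ^ (1 / β)) / (n : ℝ) ^ (1 / p)) ^ α) ∂P
      ≤ C * ∫⁻ ω, ENNReal.ofReal (min (h (X 0 ω) / (n : ℝ) ^ (1 / β)) 1 ^ α) ∂P := by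
  obtain ⟨C, hC⟩ := M.weight_rpow
  refine ⟨C, ?_⟩
  filter_upwards [hC, eventually_ge_atTop 1] with n hn hn1
  have hn0 : (0 : ℝ) < n := by exact_mod_cast hn1
  set a := (n : ℝ) ^ (1 / β) with ha
  have ha0 : 0 < a := by positivity
  have hpt : ∀ w x, ENNReal.ofReal ((g w * min (h x) a / (n : ℝ) ^ (1 / p)) ^ α)
      ≤ ‖w‖ₑ ^ α * ENNReal.ofReal ((n : ℝ)⁻¹ * min (h x / a) 1 ^ α) := by
    intro w x
    have hx0 : 0 ≤ min (h x / a) 1 := le_min (div_nonneg (hh x) ha0.le) zero_le_one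
    rw [Real.enorm_eq_ofReal_abs, ENNReal.ofReal_rpow_of_nonneg (abs_nonneg w) M.alpha_pos.le,
      ← ENNReal.ofReal_mul (by positivity)]
    refine ENNReal.ofReal_le_ofReal ?_
    have e1 : min (h x) a = a * min (h x / a) 1 := by
      rw [mul_min_of_nonneg _ _ ha0.le, mul_div_cancel₀ _ ha0.ne', mul_one]
    have e2 : (n : ℝ) ^ (1 / p) = a * (n : ℝ) ^ (1 / α) := by
      rw [ha, ← Real.rpow_add hn0]
      congr 1
      rw [one_div, ← M.inv_add_inv]; ring
    have e3 : g w * min (h x) a / (n : ℝ) ^ (1 / p)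
        = g w * (min (h x / a) 1 / (n : ℝ) ^ (1 / α)) := by
      rw [e1, e2]; field_simp
    have e4 : ((n : ℝ) ^ (1 / α)) ^ α = n := by
      rw [← Real.rpow_mul hn0.le, one_div_mul_cancel M.alpha_pos.ne', Real.rpow_one]
    rw [e3, Real.mul_rpow (hg.nonneg w) (by positivity), Real.div_rpow hx0 (by positivity), e4,
      div_eq_inv_mul]
    exact mul_le_mul_of_nonneg_right
      (Real.rpow_le_rpow (hg.nonneg w) (hg.le_abs w) M.alpha_pos.le) (by positivity)
  calc _ ≤ ∑ j : Fin n, ∫⁻ ω, ‖W n j ω‖ₑ ^ α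
          * ENNReal.ofReal ((n : ℝ)⁻¹ * min (h (X j ω) / a) 1 ^ α) ∂P :=
        Finset.sum_le_sum fun j _ => lintegral_mono fun ω => hpt _ _
    _ = (∑ j : Fin n, ∫⁻ ω, ‖W n j ω‖ₑ ^ α ∂P)
          * ∫⁻ ω, ENNReal.ofReal ((n : ℝ)⁻¹ * min (h (X 0 ω) / a) 1 ^ α) ∂P :=
        M.sum_lintegral_mul (φ := fun w => ‖w‖ₑ ^ α)
          (ψ := fun x => ENNReal.ofReal ((n : ℝ)⁻¹ * min (h x / a) 1 ^ α))
          (measurable_enorm.pow_const α)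
          ((((hhm.div_const a).min measurable_const).pow_const α).const_mul _).ennreal_ofReal n
    _ ≤ (C * n) * (ENNReal.ofReal (n : ℝ)⁻¹
          * ∫⁻ ω, ENNReal.ofReal (min (h (X 0 ω) / a) 1 ^ α) ∂P) := by
        gcongr
        rw [← lintegral_const_mul]
        · refine le_of_eq (lintegral_congr fun ω => ?_)
          rw [ENNReal.ofReal_mul (by positivity)]
        · exact ((((hhm.comp (M.measurable_sample 0)).div_const a).min
            measurable_const).pow_const α).ennreal_ofReal
    _ = _ := by
        rw [ENNReal.ofReal_inv_of_pos hn0, ENNReal.ofReal_natCast, mul_assoc,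
          ← mul_assoc (n : ℝ≥0∞), ENNReal.mul_inv_cancel (by exact_mod_cast hn0.ne')
            (ENNReal.natCast_ne_top n), one_mul]

/-- The truncation of the sample values is eventually inactive. At most finitely many `j` have
`h (X j) > j ^ (1 / β)`, and for these the growing level `n ^ (1 / β)` takes over. -/
theorem ae_eventually_forall_sample_le [IsProbabilityMeasure P]
    (M : IsWeightedSample P X W p α β) {h : ℝ → ℝ} (hhm : Measurable h) (hh : ∀ x, 0 ≤ h x)
    (hβ : ∫⁻ ω, ENNReal.ofReal (h (X 0 ω) ^ β) ∂P ≠ ∞) :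
    ∀ᵐ ω ∂P, ∀ᶠ n : ℕ in atTop, ∀ j : Fin n, h (X j ω) ≤ (n : ℝ) ^ (1 / β) := by
  have hβ0 := M.beta_pos
  have hs : ∀ᶠ n : ℕ in atTop, P {ω | (n : ℝ) ^ (1 / β) < h (X n ω)}
      ≤ ∫⁻ ω, ENNReal.ofReal (min (h (X 0 ω) / (n : ℝ) ^ (1 / β)) 1 ^ α) ∂P := by
    filter_upwards [eventually_ge_atTop 1] with n hn1
    have hn0 : (0 : ℝ) < n := by exact_mod_cast hn1
    have hms : MeasurableSet {x | (n : ℝ) ^ (1 / β) < h x} := measurableSet_lt measurable_const hhm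
    have e1 : P {ω | (n : ℝ) ^ (1 / β) < h (X n ω)} = P {ω | (n : ℝ) ^ (1 / β) < h (X 0 ω)} :=
      (M.identDistrib_sample n).measure_mem_eq hms
    have hms' : MeasurableSet {ω | (n : ℝ) ^ (1 / β) < h (X 0 ω)} := M.measurable_sample 0 hms
    rw [e1, ← lintegral_indicator_one hms']
    refine lintegral_mono fun ω => ?_
    by_cases hω : (n : ℝ) ^ (1 / β) < h (X 0 ω)
    · rw [min_eq_right ((one_le_div (by positivity)).2 hω.le), Real.one_rpow, ENNReal.ofReal_one]
      exact Set.indicator_le_self' (fun _ _ => zero_le) ω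
    · rw [Set.indicator_of_notMem (by exact hω)]
      exact zero_le
  filter_upwards [ae_eventually_notMem_of_eventually_le hs
    (M.tsum_lintegral_min_rpow_ne_top hhm hh hβ)] with ω hω
  have hat : Tendsto (fun n : ℕ => (n : ℝ) ^ (1 / β)) atTop atTop :=
    (tendsto_rpow_atTop (by positivity)).comp tendsto_natCast_atTop_atTop
  have hmono : Monotone fun n : ℕ => (n : ℝ) ^ (1 / β) := fun m n hmn =>
    Real.rpow_le_rpow (by positivity) (by exact_mod_cast hmn) (by positivity)
  have h1 : ∀ᶠ j : ℕ in atTop, h (X j ω) ≤ (j : ℝ) ^ (1 / β) := by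
    filter_upwards [hω] with j hj
    simpa using hj
  filter_upwards [eventually_forall_lt_le hmono hat h1] with n hn j
  exact hn j j.2

/-- The truncation of the products is eventually inactive, by Markov's inequality for the `α`-th
moments. -/
theorem ae_eventually_forall_mul_le [IsProbabilityMeasure P]
    (M : IsWeightedSample P X W p α β) {g h : ℝ → ℝ} (hg : IsMonotonePart g)
    (hhm : Measurable h) (hh : ∀ x, 0 ≤ h x)
    (hβ : ∫⁻ ω, ENNReal.ofReal (h (X 0 ω) ^ β) ∂P ≠ ∞) {ε : ℝ} (hε : 0 < ε) :
    ∀ᵐ ω ∂P, ∀ᶠ n : ℕ in atTop, ∀ j : Fin n,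
      g (W n j ω) * min (h (X j ω)) ((n : ℝ) ^ (1 / β)) ≤ ε * (n : ℝ) ^ (1 / p) := by
  obtain ⟨C, hC⟩ := M.exists_sum_lintegral_rpow_le hg hhm hh
  have hα0 := M.alpha_pos
  have hs : ∀ᶠ n : ℕ in atTop, P {ω | ∃ j : Fin n,
      ε * (n : ℝ) ^ (1 / p) < g (W n j ω) * min (h (X j ω)) ((n : ℝ) ^ (1 / β))}
      ≤ ENNReal.ofReal (ε⁻¹ ^ α) *
        (C * ∫⁻ ω, ENNReal.ofReal (min (h (X 0 ω) / (n : ℝ) ^ (1 / β)) 1 ^ α) ∂P) := by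
    filter_upwards [hC, eventually_ge_atTop 1] with n hn hn1
    have hn0 : (0 : ℝ) < n := by exact_mod_cast hn1
    refine le_trans ?_ (mul_le_mul_right hn _)
    rw [Set.ofPred_exists, Finset.mul_sum]
    refine (measure_iUnion_fintype_le _ _).trans (Finset.sum_le_sum fun j _ => ?_)
    have hm : Measurable fun ω => g (W n j ω) * min (h (X j ω)) ((n : ℝ) ^ (1 / β)) :=
      (hg.continuous.measurable.comp (M.measurable_weight n j)).mul
        ((hhm.comp (M.measurable_sample j)).min measurable_const)
    rw [← lintegral_const_mul _ ((hm.div_const _).pow_const α).ennreal_ofReal,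
      ← lintegral_indicator_one (measurableSet_lt measurable_const hm)]
    refine lintegral_mono fun ω => ?_
    by_cases hω : ε * (n : ℝ) ^ (1 / p) < g (W n j ω) * min (h (X j ω)) ((n : ℝ) ^ (1 / β))
    · rw [Set.indicator_of_mem (by exact hω), Pi.one_apply,
        ← ENNReal.ofReal_mul (by positivity), ENNReal.one_le_ofReal]
      have h1 : ε ≤ g (W n j ω) * min (h (X j ω)) ((n : ℝ) ^ (1 / β)) / (n : ℝ) ^ (1 / p) := by
        rw [le_div_iff₀ (by positivity)]; exact hω.le
      rw [← Real.mul_rpow (by positivity) (hε.le.trans h1)]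
      refine Real.one_le_rpow ?_ hα0.le
      rw [← div_eq_inv_mul, one_le_div hε]
      exact h1
    · rw [Set.indicator_of_notMem (by exact hω)]
      exact zero_le
  have hr : ∑' n : ℕ, ENNReal.ofReal (ε⁻¹ ^ α) *
        (C * ∫⁻ ω, ENNReal.ofReal (min (h (X 0 ω) / (n : ℝ) ^ (1 / β)) 1 ^ α) ∂P) ≠ ∞ := by
    rw [ENNReal.tsum_mul_left, ENNReal.tsum_mul_left]
    exact ENNReal.mul_ne_top ENNReal.ofReal_ne_top
      (ENNReal.mul_ne_top ENNReal.coe_ne_top (M.tsum_lintegral_min_rpow_ne_top hhm hh hβ))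
  filter_upwards [ae_eventually_notMem_of_eventually_le hs hr] with ω hω
  filter_upwards [hω] with n hn j
  simp only [not_exists, not_lt] at hn
  exact hn j

end IsWeightedSample

/-! ### The strong law for a fixed function of the sample -/

namespace IsWeightedSample

variable {Ω : Type*} [MeasurableSpace Ω] {P : Measure Ω} {X : ℕ → Ω → ℝ}
  {W : (n : ℕ) → Fin n → Ω → ℝ} {p α β : ℝ}

theorem eventually_integrable_weight (M : IsWeightedSample P X W p α β) :
    ∀ᶠ n : ℕ in atTop, ∀ j : Fin n, Integrable (W n j) P := by
  obtain ⟨C, hC⟩ := M.weight_one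
  have hp := M.p_pos
  filter_upwards [hC] with n hn j
  refine ⟨(M.measurable_weight n j).aestronglyMeasurable, ?_⟩
  rw [hasFiniteIntegral_iff_enorm]
  refine lt_of_le_of_lt ((Finset.single_le_sum (f := fun j : Fin n => ∫⁻ ω, ‖W n j ω‖ₑ ∂P)
    (fun _ _ => zero_le) (Finset.mem_univ j)).trans hn) ?_
  exact ENNReal.mul_lt_top ENNReal.coe_lt_top
    (ENNReal.rpow_lt_top_of_nonneg (by positivity) (ENNReal.natCast_ne_top n))

theorem integrable_comp_sample [IsProbabilityMeasure P] (M : IsWeightedSample P X W p α β)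
    {h : ℝ → ℝ} (hhm : Measurable h) (hβ : ∫⁻ ω, ENNReal.ofReal (|h (X 0 ω)| ^ β) ∂P ≠ ∞)
    (j : ℕ) : Integrable (fun ω => h (X j ω)) P := by
  refine ⟨(hhm.comp (M.measurable_sample j)).aestronglyMeasurable, ?_⟩
  rw [hasFiniteIntegral_iff_enorm, M.lintegral_comp_sample (ψ := fun x => ‖h x‖ₑ) hhm.enorm]
  refine lt_of_le_of_lt (lintegral_mono fun ω => ?_)
    (lintegral_one_add_rpow_ne_top (h := fun x => |h x|) (fun x => abs_nonneg _) hβ).lt_top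
  rw [Real.enorm_eq_ofReal_abs]
  exact ENNReal.ofReal_le_ofReal (le_one_add_rpow (abs_nonneg _) M.one_lt.le)

theorem integrable_mul_of_indepFun (M : IsWeightedSample P X W p α β) {g h : ℝ → ℝ}
    (hgm : Measurable g) (hhm : Measurable h) {n : ℕ} {j : Fin n}
    (hW : Integrable (fun ω => g (W n j ω)) P) (hX : Integrable (fun ω => h (X j ω)) P) :
    Integrable (fun ω => g (W n j ω) * h (X j ω)) P :=
  ((M.indepFun_weight_sample n j).comp hgm hhm).integrable_mul hW hX

theorem tendsto_lintegral_sub_min [IsProbabilityMeasure P] (M : IsWeightedSample P X W p α β)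
    {h : ℝ → ℝ} (hhm : Measurable h) (hh : ∀ x, 0 ≤ h x)
    (hβ : ∫⁻ ω, ENNReal.ofReal (h (X 0 ω) ^ β) ∂P ≠ ∞) :
    Tendsto (fun n : ℕ => ∫⁻ ω, ENNReal.ofReal
      (h (X 0 ω) - min (h (X 0 ω)) ((n : ℝ) ^ (1 / β))) ∂P) atTop (𝓝 0) := by
  have hβ0 := M.beta_pos
  have hm : Measurable fun ω => h (X 0 ω) := hhm.comp (M.measurable_sample 0)
  rw [← lintegral_zero (μ := P)]
  refine tendsto_lintegral_of_dominated_convergence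
    (fun ω => ENNReal.ofReal (1 + h (X 0 ω) ^ β))
    (fun n => (hm.sub (hm.min measurable_const)).ennreal_ofReal)
    (fun n => ae_of_all _ fun ω => ENNReal.ofReal_le_ofReal ?_)
    (lintegral_one_add_rpow_ne_top hh hβ) (ae_of_all _ fun ω => ?_)
  · have h1 : 0 ≤ min (h (X 0 ω)) ((n : ℝ) ^ (1 / β)) := le_min (hh _) (by positivity)
    have h2 := le_one_add_rpow (hh (X 0 ω)) M.one_lt.le
    linarith
  · have hat : Tendsto (fun n : ℕ => (n : ℝ) ^ (1 / β)) atTop atTop :=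
      (tendsto_rpow_atTop (by positivity)).comp tendsto_natCast_atTop_atTop
    refine tendsto_const_nhds.congr' ?_
    filter_upwards [hat.eventually_ge_atTop (h (X 0 ω))] with n hn
    rw [min_eq_left hn, sub_self, ENNReal.ofReal_zero]

/-- Truncation changes the sum of the expectations by `o(n ^ (1 / p))`. -/
theorem eventually_abs_sum_integral_sub_le [IsProbabilityMeasure P]
    (M : IsWeightedSample P X W p α β) {g h : ℝ → ℝ} (hg : IsMonotonePart g)
    (hhm : Measurable h) (hh : ∀ x, 0 ≤ h x)
    (hβ : ∫⁻ ω, ENNReal.ofReal (h (X 0 ω) ^ β) ∂P ≠ ∞) {ε δ : ℝ} (hε : 0 < ε) (hδ : 0 < δ) :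
    ∀ᶠ n : ℕ in atTop,
      |∑ j : Fin n, (∫ ω, g (W n j ω) * h (X j ω) ∂P
        - ∫ ω, truncMul g h ((n : ℝ) ^ (1 / β)) (ε * (n : ℝ) ^ (1 / p)) (W n j ω) (X j ω) ∂P)|
      ≤ δ * (n : ℝ) ^ (1 / p) := by
  obtain ⟨C, hC⟩ := M.exists_sum_lintegral_rpow_le hg hhm hh
  obtain ⟨D, hD⟩ := M.weight_one
  have hp := M.p_pos
  have hα := M.alpha_pos
  have hlim : Tendsto (fun n : ℕ =>
      (D : ℝ≥0∞) * ∫⁻ ω, ENNReal.ofReal (h (X 0 ω) - min (h (X 0 ω)) ((n : ℝ) ^ (1 / β))) ∂P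
      + ENNReal.ofReal (ε * ε⁻¹ ^ α) *
        (C * ∫⁻ ω, ENNReal.ofReal (min (h (X 0 ω) / (n : ℝ) ^ (1 / β)) 1 ^ α) ∂P))
      atTop (𝓝 (D * 0 + ENNReal.ofReal (ε * ε⁻¹ ^ α) * (C * 0))) := by
    refine (ENNReal.Tendsto.const_mul (M.tendsto_lintegral_sub_min hhm hh hβ)
      (Or.inr ENNReal.coe_ne_top)).add (ENNReal.Tendsto.const_mul (ENNReal.Tendsto.const_mul
        (ENNReal.tendsto_atTop_zero_of_tsum_ne_top
          (M.tsum_lintegral_min_rpow_ne_top hhm hh hβ))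
        (Or.inr ENNReal.coe_ne_top)) (Or.inr ENNReal.ofReal_ne_top))
  simp only [mul_zero, add_zero] at hlim
  have hβ' : ∫⁻ ω, ENNReal.ofReal (|h (X 0 ω)| ^ β) ∂P ≠ ∞ := by
    simpa only [abs_of_nonneg (hh _)] using hβ
  filter_upwards [hC, hD, M.eventually_integrable_weight, eventually_ge_atTop 1,
    hlim.eventually_le_const (ENNReal.ofReal_pos.2 hδ)] with n hCn hDn hWn hn1 hln
  have hn0 : (0 : ℝ) < n := by exact_mod_cast hn1
  set a := (n : ℝ) ^ (1 / β) with ha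
  set L := (n : ℝ) ^ (1 / p) with hL
  have ha0 : 0 ≤ a := by positivity
  have hL0 : 0 < L := by positivity
  have hy0 : 0 < ε * L := by positivity
  have hgW : ∀ j : Fin n, Integrable (fun ω => g (W n j ω)) P := fun j =>
    (hWn j).mono (hg.continuous.measurable.comp (M.measurable_weight n j)).aestronglyMeasurable
      (ae_of_all _ fun ω => by
        rw [Real.norm_of_nonneg (hg.nonneg _)]; exact hg.le_abs _)
  have hint1 : ∀ j : Fin n, Integrable (fun ω => g (W n j ω) * h (X j ω)) P := fun j =>
    M.integrable_mul_of_indepFun hg.continuous.measurable hhm (hgW j)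
      (M.integrable_comp_sample hhm hβ' j)
  have hint2 : ∀ j : Fin n, Integrable (fun ω => truncMul g h a (ε * L) (W n j ω) (X j ω)) P :=
    fun j => Integrable.of_bound ((measurable_truncMul hg hhm).comp
      ((M.measurable_weight n j).prodMk (M.measurable_sample j))).aestronglyMeasurable (ε * L)
      (ae_of_all _ fun ω => by
        change ‖truncMul g h a (ε * L) (W n j ω) (X j ω)‖ ≤ ε * L
        rw [Real.norm_of_nonneg (truncMul_nonneg hg hh ha0 hy0.le _ _)]
        exact truncMul_le _ _)
  have hnn : ∀ w x, 0 ≤ g w * h x - truncMul g h a (ε * L) w x := fun w x =>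
    sub_nonneg.2 ((min_le_left _ _).trans
      (mul_le_mul_of_nonneg_left (min_le_left _ _) (hg.nonneg w)))
  -- the first term is cut off by truncating the sample value, the second by truncating the product
  have hpt : ∀ w x, ENNReal.ofReal (g w * h x - truncMul g h a (ε * L) w x)
      ≤ ‖w‖ₑ * ENNReal.ofReal (h x - min (h x) a)
        + ENNReal.ofReal (L * (ε * ε⁻¹ ^ α)) * ENNReal.ofReal ((g w * min (h x) a / L) ^ α) := by
    intro w x
    have hd : 0 ≤ h x - min (h x) a := sub_nonneg.2 (min_le_left _ _)
    have hz : 0 ≤ g w * min (h x) a := mul_nonneg (hg.nonneg w) (le_min (hh x) ha0)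
    rw [Real.enorm_eq_ofReal_abs, ← ENNReal.ofReal_mul (abs_nonneg w),
      ← ENNReal.ofReal_mul (by positivity), ← ENNReal.ofReal_add (by positivity) (by positivity)]
    refine ENNReal.ofReal_le_ofReal ?_
    have h1 : g w * (h x - min (h x) a) ≤ |w| * (h x - min (h x) a) :=
      mul_le_mul_of_nonneg_right (hg.le_abs w) hd
    have h2 : g w * min (h x) a - truncMul g h a (ε * L) w x
        ≤ L * (ε * ε⁻¹ ^ α) * (g w * min (h x) a / L) ^ α := by
      rw [truncMul]
      set z := g w * min (h x) a
      rcases le_total z (ε * L) with hzy | hzy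
      · rw [min_eq_left hzy, sub_self]; positivity
      · rw [min_eq_right hzy]
        have h3 : 1 ≤ ε⁻¹ * (z / L) := by
          rw [← div_eq_inv_mul, one_le_div hε, le_div_iff₀ hL0]; exact hzy
        have h4 : ε⁻¹ * (z / L) ≤ (ε⁻¹ * (z / L)) ^ α :=
          Real.self_le_rpow_of_one_le h3 (by linarith [M.two_lt_alpha])
        rw [Real.mul_rpow (by positivity) (by positivity)] at h4
        calc z - ε * L ≤ z := by linarith
          _ = L * ε * (ε⁻¹ * (z / L)) := by field_simp
          _ ≤ L * ε * (ε⁻¹ ^ α * (z / L) ^ α) := mul_le_mul_of_nonneg_left h4 (by positivity)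
          _ = _ := by ring
    nlinarith
  have hm3 : ∀ j : Fin n, Measurable fun ω =>
      ENNReal.ofReal ((g (W n j ω) * min (h (X j ω)) a / L) ^ α) := fun j =>
    ((((hg.continuous.measurable.comp (M.measurable_weight n j)).mul
        ((hhm.comp (M.measurable_sample j)).min measurable_const)).div_const _).pow_const
          α).ennreal_ofReal
  have hψm : Measurable fun x => ENNReal.ofReal (h x - min (h x) a) :=
    (hhm.sub (hhm.min measurable_const)).ennreal_ofReal
  have hnp : (n : ℝ≥0∞) ^ (1 / p) = ENNReal.ofReal L := by
    rw [hL, ← ENNReal.ofReal_rpow_of_pos hn0, ENNReal.ofReal_natCast]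
  have hmain : ∑ j : Fin n, ∫⁻ ω, ENNReal.ofReal
      (g (W n j ω) * h (X j ω) - truncMul g h a (ε * L) (W n j ω) (X j ω)) ∂P
      ≤ ENNReal.ofReal (δ * L) := by
    calc _ ≤ ∑ j : Fin n, ∫⁻ ω, (‖W n j ω‖ₑ * ENNReal.ofReal (h (X j ω) - min (h (X j ω)) a)
            + ENNReal.ofReal (L * (ε * ε⁻¹ ^ α)) *
              ENNReal.ofReal ((g (W n j ω) * min (h (X j ω)) a / L) ^ α)) ∂P :=
          Finset.sum_le_sum fun j _ => lintegral_mono fun ω => hpt _ _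
      _ = (∑ j : Fin n, ∫⁻ ω, ‖W n j ω‖ₑ ∂P)
            * (∫⁻ ω, ENNReal.ofReal (h (X 0 ω) - min (h (X 0 ω)) a) ∂P)
          + ENNReal.ofReal (L * (ε * ε⁻¹ ^ α)) * ∑ j : Fin n, ∫⁻ ω,
              ENNReal.ofReal ((g (W n j ω) * min (h (X j ω)) a / L) ^ α) ∂P := by
          rw [← M.sum_lintegral_mul (φ := fun w => ‖w‖ₑ)
            (ψ := fun x => ENNReal.ofReal (h x - min (h x) a)) measurable_enorm hψm,
            Finset.mul_sum, ← Finset.sum_add_distrib]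
          refine Finset.sum_congr rfl fun j _ => ?_
          rw [lintegral_add_right _ ((hm3 j).const_mul _), lintegral_const_mul _ (hm3 j)]
      _ ≤ (D * ENNReal.ofReal L)
            * (∫⁻ ω, ENNReal.ofReal (h (X 0 ω) - min (h (X 0 ω)) a) ∂P)
          + ENNReal.ofReal (L * (ε * ε⁻¹ ^ α)) *
            (C * ∫⁻ ω, ENNReal.ofReal (min (h (X 0 ω) / a) 1 ^ α) ∂P) := by
          rw [← hnp]; gcongr
      _ = ENNReal.ofReal L * (D * (∫⁻ ω, ENNReal.ofReal (h (X 0 ω) - min (h (X 0 ω)) a) ∂P)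
          + ENNReal.ofReal (ε * ε⁻¹ ^ α) *
            (C * ∫⁻ ω, ENNReal.ofReal (min (h (X 0 ω) / a) 1 ^ α) ∂P)) := by
          rw [ENNReal.ofReal_mul hL0.le]; ring
      _ ≤ ENNReal.ofReal L * ENNReal.ofReal δ := by gcongr
      _ = ENNReal.ofReal (δ * L) := by rw [← ENNReal.ofReal_mul hL0.le, mul_comm]
  have hsum : ∑ j : Fin n, (∫ ω, g (W n j ω) * h (X j ω) ∂P
        - ∫ ω, truncMul g h a (ε * L) (W n j ω) (X j ω) ∂P)
      = ∑ j : Fin n, ∫ ω, (g (W n j ω) * h (X j ω)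
        - truncMul g h a (ε * L) (W n j ω) (X j ω)) ∂P :=
    Finset.sum_congr rfl fun j _ => (integral_sub (hint1 j) (hint2 j)).symm
  have hi0 : ∀ j : Fin n, 0 ≤ ∫ ω, (g (W n j ω) * h (X j ω)
        - truncMul g h a (ε * L) (W n j ω) (X j ω)) ∂P := fun j =>
    integral_nonneg fun ω => hnn _ _
  rw [hsum, abs_of_nonneg (Finset.sum_nonneg fun j _ => hi0 j),
    ← ENNReal.ofReal_le_ofReal_iff (by positivity), ENNReal.ofReal_sum_of_nonneg fun j _ => hi0 j]
  refine le_trans (le_of_eq (Finset.sum_congr rfl fun j _ => ?_)) hmain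
  exact ofReal_integral_eq_lintegral_ofReal ((hint1 j).sub (hint2 j))
    (ae_of_all _ fun ω => hnn _ _)

/-- The strong law for one nonnegative function of the sample and one monotone part of the
weights. -/
theorem ae_eventually_abs_sum_sub_le_of_nonneg [IsProbabilityMeasure P]
    (M : IsWeightedSample P X W p α β) {g h : ℝ → ℝ} (hg : IsMonotonePart g)
    (hhm : Measurable h) (hh : ∀ x, 0 ≤ h x)
    (hβ : ∫⁻ ω, ENNReal.ofReal (h (X 0 ω) ^ β) ∂P ≠ ∞) {δ : ℝ} (hδ : 0 < δ) :
    ∀ᵐ ω ∂P, ∀ᶠ n : ℕ in atTop,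
      |∑ j : Fin n, (g (W n j ω) * h (X j ω) - ∫ ω', g (W n j ω') * h (X j ω') ∂P)|
        ≤ δ * (n : ℝ) ^ (1 / p) := by
  obtain ⟨ε, hε, hdev⟩ := M.exists_ae_eventually_abs_sum_sub_lt hg hhm hh hβ (half_pos hδ)
  have hmean := M.eventually_abs_sum_integral_sub_le hg hhm hh hβ hε (half_pos hδ)
  filter_upwards [hdev, M.ae_eventually_forall_sample_le hhm hh hβ,
    M.ae_eventually_forall_mul_le hg hhm hh hβ hε] with ω h1 h2 h3
  filter_upwards [h1, h2, h3, hmean] with n h1 h2 h3 h4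
  have e1 : ∀ j : Fin n, g (W n j ω) * h (X j ω)
      = truncMul g h ((n : ℝ) ^ (1 / β)) (ε * (n : ℝ) ^ (1 / p)) (W n j ω) (X j ω) := fun j => by
    rw [truncMul, min_eq_left (h3 j), min_eq_left (h2 j)]
  have e2 : ∑ j : Fin n, (g (W n j ω) * h (X j ω) - ∫ ω', g (W n j ω') * h (X j ω') ∂P)
      = ∑ j : Fin n,
        (truncMul g h ((n : ℝ) ^ (1 / β)) (ε * (n : ℝ) ^ (1 / p)) (W n j ω) (X j ω)
          - ∫ ω', truncMul g h ((n : ℝ) ^ (1 / β)) (ε * (n : ℝ) ^ (1 / p))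
            (W n j ω') (X j ω') ∂P)
        - ∑ j : Fin n, (∫ ω', g (W n j ω') * h (X j ω') ∂P
          - ∫ ω', truncMul g h ((n : ℝ) ^ (1 / β)) (ε * (n : ℝ) ^ (1 / p))
            (W n j ω') (X j ω') ∂P) := by
    rw [← Finset.sum_sub_distrib]
    refine Finset.sum_congr rfl fun j _ => ?_
    rw [e1]; ring
  rw [e2]
  refine (abs_sub _ _).trans ?_
  linarith

end IsWeightedSample

theorem isMonotonePart_posPart : IsMonotonePart fun w => max w 0 where
  continuous := continuous_id.max continuous_const
  nonneg _ := le_max_right _ _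
  le_abs w := max_le (le_abs_self w) (abs_nonneg w)
  monotone_or := Or.inl fun _ _ h => max_le_max_right 0 h

theorem isMonotonePart_negPart : IsMonotonePart fun w => max (-w) 0 where
  continuous := continuous_neg.max continuous_const
  nonneg _ := le_max_right _ _
  le_abs w := max_le (neg_le_abs w) (abs_nonneg w)
  monotone_or := Or.inr fun _ _ h => max_le_max_right 0 (neg_le_neg h)

namespace IsWeightedSample

variable {Ω : Type*} [MeasurableSpace Ω] {P : Measure Ω} {X : ℕ → Ω → ℝ}
  {W : (n : ℕ) → Fin n → Ω → ℝ} {p α β : ℝ}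

theorem integrable_part_mul [IsProbabilityMeasure P]
    (M : IsWeightedSample P X W p α β) {g h : ℝ → ℝ} (hg : IsMonotonePart g) (hhm : Measurable h)
    (hβ : ∫⁻ ω, ENNReal.ofReal (|h (X 0 ω)| ^ β) ∂P ≠ ∞) {n : ℕ} {j : Fin n}
    (hW : Integrable (W n j) P) : Integrable (fun ω => g (W n j ω) * h (X j ω)) P :=
  M.integrable_mul_of_indepFun hg.continuous.measurable hhm
    (hW.mono (hg.continuous.measurable.comp (M.measurable_weight n j)).aestronglyMeasurable
      (ae_of_all _ fun ω => by
        rw [Real.norm_of_nonneg (hg.nonneg _)]; exact hg.le_abs _))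
    (M.integrable_comp_sample hhm hβ j)

theorem ae_eventually_abs_sum_sub_le_of_isMonotonePart [IsProbabilityMeasure P]
    (M : IsWeightedSample P X W p α β) {g h : ℝ → ℝ} (hg : IsMonotonePart g)
    (hhm : Measurable h) (hβ : ∫⁻ ω, ENNReal.ofReal (|h (X 0 ω)| ^ β) ∂P ≠ ∞) {δ : ℝ}
    (hδ : 0 < δ) :
    ∀ᵐ ω ∂P, ∀ᶠ n : ℕ in atTop,
      |∑ j : Fin n, (g (W n j ω) * h (X j ω) - ∫ ω', g (W n j ω') * h (X j ω') ∂P)|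
        ≤ δ * (n : ℝ) ^ (1 / p) := by
  have hpart : ∀ k : ℝ → ℝ, (∀ x, 0 ≤ k x) → (∀ x, k x ≤ |h x|) →
      ∫⁻ ω, ENNReal.ofReal (k (X 0 ω) ^ β) ∂P ≠ ∞ := fun k hk0 hk =>
    ne_top_of_le_ne_top hβ (lintegral_mono fun ω => ENNReal.ofReal_le_ofReal
      (Real.rpow_le_rpow (hk0 _) (hk _) M.beta_pos.le))
  have hp := hpart (fun x => max (h x) 0) (fun x => le_max_right _ _)
    (fun x => max_le (le_abs_self _) (abs_nonneg _))
  have hn := hpart (fun x => max (-h x) 0) (fun x => le_max_right _ _)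
    (fun x => max_le (neg_le_abs _) (abs_nonneg _))
  have hpm : Measurable fun x => max (h x) 0 := hhm.max measurable_const
  have hnm : Measurable fun x => max (-h x) 0 := hhm.neg.max measurable_const
  have hp' : ∫⁻ ω, ENNReal.ofReal (|max (h (X 0 ω)) 0| ^ β) ∂P ≠ ∞ := by
    simpa only [abs_of_nonneg (le_max_right _ (0 : ℝ))] using hp
  have hn' : ∫⁻ ω, ENNReal.ofReal (|max (-h (X 0 ω)) 0| ^ β) ∂P ≠ ∞ := by
    simpa only [abs_of_nonneg (le_max_right _ (0 : ℝ))] using hn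
  filter_upwards [M.ae_eventually_abs_sum_sub_le_of_nonneg hg hpm (fun x => le_max_right _ _) hp
    (half_pos hδ), M.ae_eventually_abs_sum_sub_le_of_nonneg hg hnm (fun x => le_max_right _ _) hn
    (half_pos hδ)] with ω h1 h2
  filter_upwards [h1, h2, M.eventually_integrable_weight] with n h1 h2 h3
  have e0 : ∀ x, h x = max (h x) 0 - max (-h x) 0 := fun x => by
    rcases le_total 0 (h x) with h | h
    · rw [max_eq_left h, max_eq_right (by linarith)]; ring
    · rw [max_eq_right h, max_eq_left (by linarith)]; ring
  have e1 : ∀ j : Fin n, ∫ ω', g (W n j ω') * h (X j ω') ∂P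
      = ∫ ω', g (W n j ω') * max (h (X j ω')) 0 ∂P
        - ∫ ω', g (W n j ω') * max (-h (X j ω')) 0 ∂P := fun j => by
    rw [← integral_sub (M.integrable_part_mul hg hpm hp' (h3 j))
      (M.integrable_part_mul hg hnm hn' (h3 j))]
    refine integral_congr_ae (ae_of_all _ fun ω' => ?_)
    simp only
    rw [← mul_sub, ← e0]
  have e2 : ∑ j : Fin n, (g (W n j ω) * h (X j ω) - ∫ ω', g (W n j ω') * h (X j ω') ∂P)
      = ∑ j : Fin n, (g (W n j ω) * max (h (X j ω)) 0
          - ∫ ω', g (W n j ω') * max (h (X j ω')) 0 ∂P)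
        - ∑ j : Fin n, (g (W n j ω) * max (-h (X j ω)) 0
          - ∫ ω', g (W n j ω') * max (-h (X j ω')) 0 ∂P) := by
    rw [← Finset.sum_sub_distrib]
    refine Finset.sum_congr rfl fun j _ => ?_
    rw [e1]
    nth_rewrite 1 [e0 (X j ω)]
    ring
  rw [e2]
  refine (abs_sub _ _).trans ?_
  linarith

/-- The strong law for one function of the sample, with weights `W⁺ + σ W⁻`: these are `W` for
`σ = -1` and `|W|` for `σ = 1`. -/
theorem ae_eventually_abs_sum_sub_le [IsProbabilityMeasure P]
    (M : IsWeightedSample P X W p α β) {h : ℝ → ℝ} (hhm : Measurable h)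
    (hβ : ∫⁻ ω, ENNReal.ofReal (|h (X 0 ω)| ^ β) ∂P ≠ ∞) {σ δ : ℝ} (hσ : |σ| = 1) (hδ : 0 < δ) :
    ∀ᵐ ω ∂P, ∀ᶠ n : ℕ in atTop,
      |∑ j : Fin n, ((max (W n j ω) 0 + σ * max (-W n j ω) 0) * h (X j ω)
        - ∫ ω', (max (W n j ω') 0 + σ * max (-W n j ω') 0) * h (X j ω') ∂P)|
        ≤ δ * (n : ℝ) ^ (1 / p) := by
  filter_upwards [M.ae_eventually_abs_sum_sub_le_of_isMonotonePart isMonotonePart_posPart hhm hβ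
    (half_pos hδ), M.ae_eventually_abs_sum_sub_le_of_isMonotonePart isMonotonePart_negPart hhm hβ
    (half_pos hδ)] with ω h1 h2
  filter_upwards [h1, h2, M.eventually_integrable_weight] with n h1 h2 h3
  have e1 : ∀ j : Fin n, ∫ ω', (max (W n j ω') 0 + σ * max (-W n j ω') 0) * h (X j ω') ∂P
      = ∫ ω', max (W n j ω') 0 * h (X j ω') ∂P
        + σ * ∫ ω', max (-W n j ω') 0 * h (X j ω') ∂P := fun j => by
    rw [← integral_const_mul, ← integral_add
      (M.integrable_part_mul isMonotonePart_posPart hhm hβ (h3 j))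
      ((M.integrable_part_mul isMonotonePart_negPart hhm hβ (h3 j)).const_mul σ)]
    refine integral_congr_ae (ae_of_all _ fun ω' => ?_)
    simp only
    ring
  have e2 : ∑ j : Fin n, ((max (W n j ω) 0 + σ * max (-W n j ω) 0) * h (X j ω)
        - ∫ ω', (max (W n j ω') 0 + σ * max (-W n j ω') 0) * h (X j ω') ∂P)
      = ∑ j : Fin n, (max (W n j ω) 0 * h (X j ω) - ∫ ω', max (W n j ω') 0 * h (X j ω') ∂P)
        + σ * ∑ j : Fin n, (max (-W n j ω) 0 * h (X j ω)
          - ∫ ω', max (-W n j ω') 0 * h (X j ω') ∂P) := by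
    rw [Finset.mul_sum, ← Finset.sum_add_distrib]
    refine Finset.sum_congr rfl fun j _ => ?_
    rw [e1]
    ring
  rw [e2]
  refine (abs_add_le _ _).trans ?_
  rw [abs_mul, hσ, one_mul]
  linarith

theorem ae_eventually_abs_sum_weight_mul_sub_le [IsProbabilityMeasure P]
    (M : IsWeightedSample P X W p α β) {h : ℝ → ℝ} (hhm : Measurable h)
    (hβ : ∫⁻ ω, ENNReal.ofReal (|h (X 0 ω)| ^ β) ∂P ≠ ∞) {δ : ℝ} (hδ : 0 < δ) :
    ∀ᵐ ω ∂P, ∀ᶠ n : ℕ in atTop,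
      |∑ j : Fin n, (W n j ω * h (X j ω) - ∫ ω', W n j ω' * h (X j ω') ∂P)|
        ≤ δ * (n : ℝ) ^ (1 / p) := by
  have e : ∀ w : ℝ, max w 0 + -1 * max (-w) 0 = w := fun w => by
    rcases le_total 0 w with h | h
    · rw [max_eq_left h, max_eq_right (by linarith)]; ring
    · rw [max_eq_right h, max_eq_left (by linarith)]; ring
  have := M.ae_eventually_abs_sum_sub_le hhm hβ (σ := -1) (by simp) hδ
  simpa only [e] using this

theorem ae_eventually_abs_sum_abs_weight_mul_sub_le [IsProbabilityMeasure P]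
    (M : IsWeightedSample P X W p α β) {h : ℝ → ℝ} (hhm : Measurable h)
    (hβ : ∫⁻ ω, ENNReal.ofReal (|h (X 0 ω)| ^ β) ∂P ≠ ∞) {δ : ℝ} (hδ : 0 < δ) :
    ∀ᵐ ω ∂P, ∀ᶠ n : ℕ in atTop,
      |∑ j : Fin n, (|W n j ω| * h (X j ω) - ∫ ω', |W n j ω'| * h (X j ω') ∂P)|
        ≤ δ * (n : ℝ) ^ (1 / p) := by
  have e : ∀ w : ℝ, max w 0 + 1 * max (-w) 0 = |w| := fun w => by
    rcases le_total 0 w with h | h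
    · rw [max_eq_left h, max_eq_right (by linarith), abs_of_nonneg h]; ring
    · rw [max_eq_right h, max_eq_left (by linarith), abs_of_nonpos h]; ring
  have := M.ae_eventually_abs_sum_sub_le hhm hβ (σ := 1) (by simp) hδ
  simpa only [e] using this

end IsWeightedSample

/-! ### Uniformity in the parameter -/

section Oscillation

variable {T : Type*} [TopologicalSpace T]

/-- The largest deviation, in `[0, ∞]`, of `H θ x` from `H θ₀ x` for `θ` in the set `U`. -/
noncomputable def deviation (H : T → ℝ → ℝ) (U : Set T) (θ₀ : T) (x : ℝ) : ℝ≥0∞ :=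
  ⨆ θ ∈ U, ‖H θ x - H θ₀ x‖ₑ

theorem measurable_deviation [TopologicalSpace.SeparableSpace T] {H : T → ℝ → ℝ}
    (hHc : ∀ x, Continuous fun θ => H θ x) (hHm : ∀ θ, Measurable (H θ)) {U : Set T}
    (hU : IsOpen U) (θ₀ : T) : Measurable (deviation H U θ₀) := by
  obtain ⟨s, hsc, hsd⟩ := TopologicalSpace.exists_countable_dense T
  -- by continuity, the supremum may be taken over the countable set `U ∩ s`
  have h1 : deviation H U θ₀ = fun x => ⨆ θ ∈ U ∩ s, ‖H θ x - H θ₀ x‖ₑ := by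
    funext x
    refine le_antisymm (iSup₂_le fun θ hθ => ?_) (iSup₂_le fun θ hθ => ?_)
    · have hcl : IsClosed {θ | ‖H θ x - H θ₀ x‖ₑ ≤ ⨆ θ ∈ U ∩ s, ‖H θ x - H θ₀ x‖ₑ} :=
        isClosed_le ((hHc x).sub continuous_const).enorm continuous_const
      exact closure_minimal (fun θ hθ => le_iSup₂ (f := fun θ (_ : θ ∈ U ∩ s) =>
        ‖H θ x - H θ₀ x‖ₑ) θ hθ) hcl (hsd.open_subset_closure_inter hU hθ)
    · exact le_iSup₂ (f := fun θ (_ : θ ∈ U) => ‖H θ x - H θ₀ x‖ₑ) θ hθ.1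
  rw [h1]
  exact Measurable.biSup _ (hsc.mono Set.inter_subset_right) fun θ _ =>
    ((hHm θ).sub (hHm θ₀)).enorm

theorem deviation_le {T : Type*} (H : T → ℝ → ℝ) (U : Set T) (θ₀ : T) (x : ℝ) {β : ℝ} (hβ : 0 < β) :
    deviation H U θ₀ x ≤ 2 * (⨆ θ, ‖H θ x‖ₑ ^ β) ^ (1 / β) := by
  have h1 : ∀ θ, ‖H θ x‖ₑ ≤ (⨆ θ, ‖H θ x‖ₑ ^ β) ^ (1 / β) := fun θ => by
    rw [one_div, ENNReal.le_rpow_inv_iff hβ]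
    exact le_iSup (fun θ => ‖H θ x‖ₑ ^ β) θ
  refine iSup₂_le fun θ _ => (enorm_sub_le).trans ?_
  rw [two_mul]
  exact add_le_add (h1 θ) (h1 θ₀)

theorem iSup_enorm_rpow_lt_top [CompactSpace T] {H : T → ℝ → ℝ} {x : ℝ}
    (hHc : Continuous fun θ => H θ x) {β : ℝ} (hβ : 0 < β) : ⨆ θ, ‖H θ x‖ₑ ^ β < ∞ := by
  obtain ⟨C, hC⟩ := isCompact_univ.exists_bound_of_continuousOn hHc.continuousOn
  refine lt_of_le_of_lt (iSup_le fun θ => ENNReal.rpow_le_rpow (?_ : _ ≤ ENNReal.ofReal C) hβ.le)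
    (ENNReal.rpow_lt_top_of_nonneg hβ.le ENNReal.ofReal_ne_top)
  rw [← ofReal_norm]
  exact ENNReal.ofReal_le_ofReal (hC θ (Set.mem_univ θ))

end Oscillation

theorem tendsto_deviation_ball {T : Type*} [PseudoMetricSpace T] {H : T → ℝ → ℝ} {x : ℝ}
    (hHc : Continuous fun θ => H θ x) (θ₀ : T) :
    Tendsto (fun k : ℕ => deviation H (Metric.ball θ₀ (1 / (k + 1 : ℝ))) θ₀ x) atTop (𝓝 0) := by
  rw [ENNReal.tendsto_nhds_zero]
  intro ε hε
  have h1 : Tendsto (fun θ => ‖H θ x - H θ₀ x‖ₑ) (𝓝 θ₀) (𝓝 0) := by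
    have := ((hHc.sub (continuous_const (y := H θ₀ x))).enorm).tendsto θ₀
    simpa using this
  obtain ⟨r, hr, hball⟩ := Metric.eventually_nhds_iff_ball.1 (h1.eventually_le_const hε)
  obtain ⟨k, hk⟩ := exists_nat_one_div_lt hr
  filter_upwards [eventually_ge_atTop k] with m hm
  exact iSup₂_le fun θ hθ => hball θ (Metric.ball_subset_ball
    ((Nat.one_div_le_one_div hm).trans hk.le) hθ)

namespace IsWeightedSample

variable {Ω : Type*} [MeasurableSpace Ω] {P : Measure Ω} {X : ℕ → Ω → ℝ}
  {W : (n : ℕ) → Fin n → Ω → ℝ} {p α β : ℝ}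

/-- Near each parameter, `H` varies by at most a function `o` of the sample with small mean. -/
theorem exists_ball_abs_sub_le [IsProbabilityMeasure P] (M : IsWeightedSample P X W p α β)
    {T : Type*} [PseudoMetricSpace T] [CompactSpace T] {H : T → ℝ → ℝ}
    (hHc : ∀ x, Continuous fun θ => H θ x) (hHm : ∀ θ, Measurable (H θ))
    (hH : ∫⁻ ω, ⨆ θ, ‖H θ (X 0 ω)‖ₑ ^ β ∂P < ∞) (θ₀ : T) {η : ℝ} (hη : 0 < η) :
    ∃ r > 0, ∃ o : ℝ → ℝ, Measurable o ∧ (∀ x, 0 ≤ o x) ∧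
      (∀ θ ∈ Metric.ball θ₀ r, ∀ x, |H θ x - H θ₀ x| ≤ o x) ∧
      ∫⁻ ω, ENNReal.ofReal (o (X 0 ω)) ∂P ≤ ENNReal.ofReal η ∧
      ∫⁻ ω, ENNReal.ofReal (|o (X 0 ω)| ^ β) ∂P ≠ ∞ := by
  have hβ := M.beta_pos
  set m : ℝ → ℝ≥0∞ := fun x => ⨆ θ, ‖H θ x‖ₑ ^ β with hm
  have hfin : ∀ U x, deviation H U θ₀ x ≠ ∞ := fun U x =>
    ne_top_of_le_ne_top (ENNReal.mul_ne_top ENNReal.ofNat_ne_top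
      (ENNReal.rpow_lt_top_of_nonneg (by positivity)
        (iSup_enorm_rpow_lt_top (hHc x) hβ).ne).ne) (deviation_le H U θ₀ x hβ)
  have hdm : ∀ r, Measurable (deviation H (Metric.ball θ₀ r) θ₀) := fun r =>
    measurable_deviation hHc hHm Metric.isOpen_ball θ₀
  have hroot : ∀ s : ℝ≥0∞, s ^ (1 / β) ≤ 1 + s := fun s => by
    rcases le_total s 1 with h | h
    · exact (ENNReal.rpow_le_one h (by positivity)).trans le_self_add
    · refine le_trans ?_ le_add_self
      calc s ^ (1 / β) ≤ s ^ (1 : ℝ) := ENNReal.rpow_le_rpow_of_exponent_le h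
            ((div_le_one hβ).2 M.one_lt.le)
        _ = s := ENNReal.rpow_one s
  have hlim : Tendsto (fun k : ℕ => ∫⁻ ω,
      deviation H (Metric.ball θ₀ (1 / (k + 1 : ℝ))) θ₀ (X 0 ω) ∂P) atTop (𝓝 0) := by
    rw [← lintegral_zero (μ := P)]
    refine tendsto_lintegral_of_dominated_convergence (fun ω => 2 * (1 + m (X 0 ω)))
      (fun k => (hdm _).comp (M.measurable_sample 0))
      (fun k => ae_of_all _ fun ω => (deviation_le H _ θ₀ _ hβ).trans ?_) ?_
      (ae_of_all _ fun ω => tendsto_deviation_ball (hHc _) θ₀)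
    · exact mul_le_mul_right (hroot _) _
    · rw [lintegral_const_mul' _ _ ENNReal.ofNat_ne_top, lintegral_add_left measurable_const]
      exact ENNReal.mul_ne_top ENNReal.ofNat_ne_top
        (ENNReal.add_ne_top.2 ⟨by simp, hH.ne⟩)
  obtain ⟨k, hk⟩ := (hlim.eventually_le_const (ENNReal.ofReal_pos.2 hη)).exists
  refine ⟨1 / (k + 1 : ℝ), Nat.one_div_pos_of_nat,
    fun x => (deviation H (Metric.ball θ₀ (1 / (k + 1 : ℝ))) θ₀ x).toReal,
    (hdm _).ennreal_toReal, fun x => ENNReal.toReal_nonneg, fun θ hθ x => ?_, ?_, ?_⟩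
  · rw [← ENNReal.ofReal_le_iff_le_toReal (hfin _ _), ← Real.enorm_eq_ofReal_abs]
    exact le_iSup₂ (f := fun θ (_ : θ ∈ Metric.ball θ₀ (1 / (k + 1 : ℝ))) =>
      ‖H θ x - H θ₀ x‖ₑ) θ hθ
  · refine le_trans (lintegral_mono fun ω => ?_) hk
    rw [ENNReal.ofReal_toReal (hfin _ _)]
  · refine ne_top_of_le_ne_top (b := 2 ^ β * ∫⁻ ω, m (X 0 ω) ∂P) (ENNReal.mul_ne_top
      (ENNReal.rpow_lt_top_of_nonneg hβ.le ENNReal.ofNat_ne_top).ne hH.ne) ?_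
    rw [← lintegral_const_mul' _ _
      (ENNReal.rpow_lt_top_of_nonneg hβ.le ENNReal.ofNat_ne_top).ne]
    refine lintegral_mono fun ω => ?_
    rw [abs_of_nonneg ENNReal.toReal_nonneg, ← ENNReal.ofReal_rpow_of_nonneg
      ENNReal.toReal_nonneg hβ.le, ENNReal.ofReal_toReal (hfin _ _)]
    calc _ ≤ (2 * (m (X 0 ω)) ^ (1 / β)) ^ β :=
          ENNReal.rpow_le_rpow (deviation_le H _ θ₀ _ hβ) hβ.le
      _ = 2 ^ β * m (X 0 ω) := by
          rw [ENNReal.mul_rpow_of_nonneg _ _ hβ.le, ← ENNReal.rpow_mul,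
            one_div_mul_cancel hβ.ne', ENNReal.rpow_one]

theorem lintegral_abs_rpow_ne_top {T : Type*} {H : T → ℝ → ℝ} (hβ : 0 ≤ β)
    (hH : ∫⁻ ω, ⨆ θ, ‖H θ (X 0 ω)‖ₑ ^ β ∂P < ∞) (θ : T) :
    ∫⁻ ω, ENNReal.ofReal (|H θ (X 0 ω)| ^ β) ∂P ≠ ∞ := by
  refine ne_top_of_le_ne_top hH.ne (lintegral_mono fun ω => ?_)
  rw [← ENNReal.ofReal_rpow_of_nonneg (abs_nonneg _) hβ, ← Real.enorm_eq_ofReal_abs]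
  exact le_iSup (fun θ => ‖H θ (X 0 ω)‖ₑ ^ β) θ

/-- The strong law, uniformly over a small ball of parameters. -/
theorem exists_ball_ae_eventually_forall_abs_sum_sub_le [IsProbabilityMeasure P]
    (M : IsWeightedSample P X W p α β)
    {T : Type*} [PseudoMetricSpace T] [CompactSpace T] {H : T → ℝ → ℝ}
    (hHc : ∀ x, Continuous fun θ => H θ x) (hHm : ∀ θ, Measurable (H θ))
    (hH : ∫⁻ ω, ⨆ θ, ‖H θ (X 0 ω)‖ₑ ^ β ∂P < ∞) (θ₀ : T) {δ : ℝ} (hδ : 0 < δ) :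
    ∃ r > 0, ∀ᵐ ω ∂P, ∀ᶠ n : ℕ in atTop, ∀ θ ∈ Metric.ball θ₀ r,
      |∑ j : Fin n, (W n j ω * H θ (X j ω) - ∫ ω', W n j ω' * H θ (X j ω') ∂P)|
        ≤ δ * (n : ℝ) ^ (1 / p) := by
  obtain ⟨D, hD⟩ := M.weight_one
  have hp := M.p_pos
  have hβ := M.beta_pos
  set η := δ / (4 * (D + 1)) with hη
  have hη0 : 0 < η := by positivity
  have hDη : D * η ≤ δ / 4 := by
    rw [hη, mul_div_assoc', div_le_div_iff₀ (by positivity) (by norm_num)]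
    nlinarith
  obtain ⟨r, hr, o, hom, ho0, hoH, ho1, hoβ⟩ := M.exists_ball_abs_sub_le hHc hHm hH θ₀ hη0
  have hHθ := lintegral_abs_rpow_ne_top (X := X) hβ.le hH
  refine ⟨r, hr, ?_⟩
  filter_upwards [M.ae_eventually_abs_sum_weight_mul_sub_le (hHm θ₀) (hHθ θ₀)
      (δ := δ / 4) (by positivity),
    M.ae_eventually_abs_sum_abs_weight_mul_sub_le hom hoβ (δ := δ / 4) (by positivity)]
    with ω h1 h2
  filter_upwards [h1, h2, hD, M.eventually_integrable_weight, eventually_ge_atTop 1]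
    with n h1 h2 h3 h4 hn1 θ hθ
  have hn0 : (0 : ℝ) < n := by exact_mod_cast hn1
  set L := (n : ℝ) ^ (1 / p) with hL
  have hL0 : 0 < L := by positivity
  have hi : ∀ (θ) (j : Fin n), Integrable (fun ω => W n j ω * H θ (X j ω)) P := fun θ j =>
    M.integrable_mul_of_indepFun measurable_id (hHm θ) (h4 j)
      (M.integrable_comp_sample (hHm θ) (hHθ θ) j)
  have hio : ∀ j : Fin n, Integrable (fun ω => |W n j ω| * o (X j ω)) P := fun j =>
    M.integrable_mul_of_indepFun (g := fun w => |w|) measurable_id.abs hom (h4 j).abs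
      (M.integrable_comp_sample hom hoβ j)
  have hnn : ∀ (j : Fin n) ω, 0 ≤ |W n j ω| * o (X j ω) := fun j ω =>
    mul_nonneg (abs_nonneg _) (ho0 _)
  have hmean : ∑ j : Fin n, ∫ ω, |W n j ω| * o (X j ω) ∂P ≤ δ / 4 * L := by
    rw [← ENNReal.ofReal_le_ofReal_iff (by positivity),
      ENNReal.ofReal_sum_of_nonneg fun j _ => integral_nonneg (hnn j)]
    have e : ∀ j : Fin n, ENNReal.ofReal (∫ ω, |W n j ω| * o (X j ω) ∂P)
        = ∫⁻ ω, ‖W n j ω‖ₑ * ENNReal.ofReal (o (X j ω)) ∂P := fun j => by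
      rw [ofReal_integral_eq_lintegral_ofReal (hio j) (ae_of_all _ (hnn j))]
      refine lintegral_congr fun ω => ?_
      rw [ENNReal.ofReal_mul (abs_nonneg _), ← Real.enorm_eq_ofReal_abs]
    simp_rw [e]
    rw [M.sum_lintegral_mul (φ := fun w => ‖w‖ₑ) (ψ := fun x => ENNReal.ofReal (o x))
      measurable_enorm hom.ennreal_ofReal]
    have hnp : (n : ℝ≥0∞) ^ (1 / p) = ENNReal.ofReal L := by
      rw [hL, ← ENNReal.ofReal_rpow_of_pos hn0, ENNReal.ofReal_natCast]
    rw [hnp] at h3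
    refine (mul_le_mul' h3 ho1).trans ?_
    rw [← ENNReal.ofReal_coe_nnreal, ← ENNReal.ofReal_mul D.coe_nonneg,
      ← ENNReal.ofReal_mul (by positivity)]
    refine ENNReal.ofReal_le_ofReal ?_
    nlinarith
  have hdiff : ∀ j : Fin n, |(W n j ω * H θ (X j ω) - ∫ ω', W n j ω' * H θ (X j ω') ∂P)
      - (W n j ω * H θ₀ (X j ω) - ∫ ω', W n j ω' * H θ₀ (X j ω') ∂P)|
      ≤ |W n j ω| * o (X j ω) + ∫ ω', |W n j ω'| * o (X j ω') ∂P := by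
    intro j
    have hpt : ∀ ω', |W n j ω' * H θ (X j ω') - W n j ω' * H θ₀ (X j ω')|
        ≤ |W n j ω'| * o (X j ω') := fun ω' => by
      rw [← mul_sub, abs_mul]
      exact mul_le_mul_of_nonneg_left (hoH θ hθ _) (abs_nonneg _)
    have hint : |∫ ω', W n j ω' * H θ (X j ω') ∂P - ∫ ω', W n j ω' * H θ₀ (X j ω') ∂P|
        ≤ ∫ ω', |W n j ω'| * o (X j ω') ∂P := by
      rw [← integral_sub (hi θ j) (hi θ₀ j)]
      exact (abs_integral_le_integral_abs).trans
        (integral_mono ((hi θ j).sub (hi θ₀ j)).abs (hio j) hpt)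
    have e : (W n j ω * H θ (X j ω) - ∫ ω', W n j ω' * H θ (X j ω') ∂P)
      - (W n j ω * H θ₀ (X j ω) - ∫ ω', W n j ω' * H θ₀ (X j ω') ∂P)
      = (W n j ω * H θ (X j ω) - W n j ω * H θ₀ (X j ω))
        - (∫ ω', W n j ω' * H θ (X j ω') ∂P - ∫ ω', W n j ω' * H θ₀ (X j ω') ∂P) := by ring
    rw [e]
    exact (abs_sub _ _).trans (add_le_add (hpt ω) hint)
  have hsum : |∑ j : Fin n, (W n j ω * H θ (X j ω) - ∫ ω', W n j ω' * H θ (X j ω') ∂P)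
      - ∑ j : Fin n, (W n j ω * H θ₀ (X j ω) - ∫ ω', W n j ω' * H θ₀ (X j ω') ∂P)|
      ≤ ∑ j : Fin n, |W n j ω| * o (X j ω) + ∑ j : Fin n, ∫ ω', |W n j ω'| * o (X j ω') ∂P := by
    rw [← Finset.sum_sub_distrib, ← Finset.sum_add_distrib]
    exact (Finset.abs_sum_le_sum_abs _ _).trans (Finset.sum_le_sum fun j _ => hdiff j)
  have h2' := (le_abs_self _).trans h2
  rw [Finset.sum_sub_distrib] at h2'
  have h5 := (abs_sub_abs_le_abs_sub _ _).trans hsum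
  linarith

theorem ae_eventually_forall_abs_sum_sub_le [IsProbabilityMeasure P]
    (M : IsWeightedSample P X W p α β)
    {T : Type*} [PseudoMetricSpace T] [CompactSpace T] {H : T → ℝ → ℝ}
    (hHc : ∀ x, Continuous fun θ => H θ x) (hHm : ∀ θ, Measurable (H θ))
    (hH : ∫⁻ ω, ⨆ θ, ‖H θ (X 0 ω)‖ₑ ^ β ∂P < ∞) {δ : ℝ} (hδ : 0 < δ) :
    ∀ᵐ ω ∂P, ∀ᶠ n : ℕ in atTop, ∀ θ,
      |∑ j : Fin n, (W n j ω * H θ (X j ω) - ∫ ω', W n j ω' * H θ (X j ω') ∂P)|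
        ≤ δ * (n : ℝ) ^ (1 / p) := by
  choose r hr hball using fun θ₀ =>
    M.exists_ball_ae_eventually_forall_abs_sum_sub_le hHc hHm hH θ₀ hδ
  obtain ⟨t, ht⟩ := isCompact_univ.elim_finite_subcover (fun θ₀ => Metric.ball θ₀ (r θ₀))
    (fun _ => Metric.isOpen_ball)
    (fun θ _ => Set.mem_iUnion.2 ⟨θ, Metric.mem_ball_self (hr θ)⟩)
  filter_upwards [(Finset.eventually_all t).2 fun θ₀ _ => hball θ₀] with ω hω
  filter_upwards [(Finset.eventually_all t).2 hω] with n hn θ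
  obtain ⟨θ₀, hθ₀, hθ⟩ := Set.mem_iUnion₂.1 (ht (Set.mem_univ θ))
  exact hn θ₀ hθ₀ θ hθ

end IsWeightedSample

theorem theorem2
    {Ω : Type*} [MeasurableSpace Ω] (P : Measure Ω) [IsProbabilityMeasure P]
    {S : Type*} [MetricSpace S] [TopologicalSpace.SeparableSpace S]
    (Θ : Set S) (hΘ : IsCompact Θ)
    (H : Θ → ℝ → ℝ)
    (hHcont : ∀ x : ℝ, Continuous fun θ : Θ => H θ x)
    (hHmeas : ∀ θ : Θ, Measurable (H θ))
    (X : ℕ → Ω → ℝ)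
    (hXmeas : ∀ i, Measurable (X i))
    (hXindep : iIndepFun X P)
    (hXident : ∀ i, IdentDistrib (X i) (X 0) P P)
    (W : (n : ℕ) → Fin n → Ω → ℝ)
    (hWmeas : ∀ n j, Measurable (W n j))
    (hWrows : iIndepFun (fun (n : ℕ) (ω : Ω) (j : Fin n) => W n j ω) P)
    (hWNOD : ∀ n, IsNOD (W n) P)
    (hWX : ∀ n, IndepFun (fun (ω : Ω) (j : Fin n) => W n j ω) (fun (ω : Ω) (i : ℕ) => X i ω) P)
    (p α β : ℝ) (hp1 : 1 ≤ p) (hp2 : p < 2) (hα : 2 * p < α) (hβ : 1 < β)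
    (hαβ : α⁻¹ + β⁻¹ = p⁻¹)
    (hHmoment : ∫⁻ ω, ⨆ θ : Θ, ‖H θ (X 0 ω)‖ₑ ^ β ∂P < ∞)
    (hWα : ∃ C : ℝ≥0, ∀ᶠ n : ℕ in atTop,
      ∑ j : Fin n, ∫⁻ ω, ‖W n j ω‖ₑ ^ α ∂P ≤ (C : ℝ≥0∞) * (n : ℝ≥0∞))
    (hW1 : ∃ C : ℝ≥0, ∀ᶠ n : ℕ in atTop,
      ∑ j : Fin n, ∫⁻ ω, ‖W n j ω‖ₑ ∂P ≤ (C : ℝ≥0∞) * (n : ℝ≥0∞) ^ (1 / p)) :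
    (∀ᶠ n : ℕ in atTop, ∀ (j : Fin n) (θ : Θ),
      Integrable (fun ω => W n j ω * H θ (X j ω)) P) ∧
    ∀ᵐ ω ∂P, Tendsto
      (fun n : ℕ => ⨆ θ : Θ,
        ‖1 / (n : ℝ) ^ (1 / p) *
          ∑ j : Fin n, (W n j ω * H θ (X j ω) - ∫ ω', W n j ω' * H θ (X j ω') ∂P)‖ₑ)
      atTop (𝓝 0) := by
  have M : IsWeightedSample P X W p α β :=
    ⟨hXmeas, hXindep, hXident, hWmeas, hWNOD, hWX, hp1, hp2, hα, hβ, hαβ, hWα, hW1⟩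
  have : CompactSpace Θ := isCompact_iff_compactSpace.1 hΘ
  have hHθ := IsWeightedSample.lintegral_abs_rpow_ne_top (X := X) M.beta_pos.le hHmoment
  refine ⟨?_, ?_⟩
  · filter_upwards [M.eventually_integrable_weight] with n hn j θ
    exact M.integrable_mul_of_indepFun measurable_id (hHmeas θ) (hn j)
      (M.integrable_comp_sample (hHmeas θ) (hHθ θ) j)
  · have key : ∀ᵐ ω ∂P, ∀ k : ℕ, ∀ᶠ n : ℕ in atTop, ∀ θ,
        |∑ j : Fin n, (W n j ω * H θ (X j ω) - ∫ ω', W n j ω' * H θ (X j ω') ∂P)|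
          ≤ 1 / (k + 1 : ℝ) * (n : ℝ) ^ (1 / p) :=
      ae_all_iff.2 fun k =>
        M.ae_eventually_forall_abs_sum_sub_le hHcont hHmeas hHmoment Nat.one_div_pos_of_nat
    filter_upwards [key] with ω hω
    have hlim : Tendsto (fun k : ℕ => ENNReal.ofReal (1 / (k + 1 : ℝ))) atTop (𝓝 0) := by
      simpa using ENNReal.tendsto_ofReal tendsto_one_div_add_atTop_nhds_zero_nat
    rw [ENNReal.tendsto_nhds_zero]
    intro ε hε
    obtain ⟨k, hk⟩ := (hlim.eventually_le_const hε).exists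
    filter_upwards [hω k, eventually_ge_atTop 1] with n hn hn1
    have hL0 : 0 < (n : ℝ) ^ (1 / p) := Real.rpow_pos_of_pos (by exact_mod_cast hn1) _
    refine iSup_le fun θ => le_trans ?_ hk
    rw [Real.enorm_eq_ofReal_abs, abs_mul, abs_of_pos (one_div_pos.2 hL0)]
    refine ENNReal.ofReal_le_ofReal ?_
    rw [one_div_mul_eq_div, div_le_iff₀ hL0]
    exact hn θ
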